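/- **Notation.** For coefficients $\alpha=(\alpha_n)_{n\ge 0}$ in $\overline{\mathbb D}$ put $\rho_n=\sqrt{1-|\alpha_n|^2}$, $\alpha_{-1}=-1$, $\rho_{-1}=0$. The CMV matrix $\mathcal C=\mathcal C(\alpha)$ is the five-diagonal operator on $\ell^2(\mathbb N_0)$ whose rows $2k$ and $2k+1$ have, in the columns $2k-1,2k,2k+1,2k+2$ (without the column $-1$ if $k=0$), the entries $$(\bar\alpha_{2k}\rho_{2k-1},\,-\bar\alpha_{2k}\alpha_{2k-1},\,\bar\alpha_{2k+1}\rho_{2k},\,\rho_{2k+1}\rho_{2k}),\qquad(\rho_{2k}\rho_{2k-1},\,-\rho_{2k}\alpha_{2k-1},\,-\bar\alpha_{2k+1}\alpha_{2k},\,-\rho_{2k+1}\alpha_{2k}),$$ and zeros elsewhere. Let $\mathcal C_n(\alpha_0,\dots,\alpha_{n-1})$ be its top-left $n\times n$ block. Off the spectrum of $\mathcal C$ put $$m(z)=\langle e_0,(z-\mathcal C)^{-1}e_0\rangle,\quad F(z)=\langle e_0,(\mathcal C+z)(\mathcal C-z)^{-1}e_0\rangle,\quad f(z)=\frac1z\,\frac{F(z)-1}{F(z)+1}\in\mathbb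 C\cup\{\infty\},$$ where $f$ (the Schur function) is extended by continuity to $z=0$ and to the isolated point masses, on the unit circle, of the spectral measure of $\mathcal C$ at $e_0$. Let $\mathcal Z(f)=\{z\in\mathbb D: f(z)=0\}$ and $\mathcal P(f)=\{z\in\mathbb C\setminus\overline{\mathbb D}: f(z)=\infty\}$. For $\alpha_{n,N}\in\mathbb D$ and $|\beta|=1$ let $\Phi_{n,N}(z)=\det(z-\mathcal C_n(\alpha_{0,N},\dots,\alpha_{n-1,N}))$, $\Phi^*_{n,N}(z)=z^n\overline{\Phi_{n,N}(1/\bar z)}$ and $\Phi^{(\beta)}_{n,N}(z)=\det(z-\mathcal C_n(\alpha_{0,N},\dots,\alpha_{n-2,N},\beta))$. For $t>0$, a limit "as $n/N\to t$" means the limit along all sequences $n_i,N_i\to\infty$ of positive integers with $n_i/N_i\to t$; a limit "as $kp/N\to t$" is the same with $n_i=k_ip$. Let $\Lambda_{\beta,t}$ be the set of those $e^{i\theta}$ for which there are sequences $n_i,N_i\to\infty$ with $n_i/N_i\to t$ and $$\liminf_{i\to\infty}\operatorname{dist}\bigl(e^{i\theta},\{z\in\partial\mathbb D:\Phi^{(\beta)}_{n_i,N_i}(z)=0\}\bigr)=0,$$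 and let $\Lambda_t=\bigcap_{|\beta|=1}\Lambda_{\beta,t}$. **Theorem.** Let $p\in\mathbb N$, $|\beta|=1$, $t>0$, let $(\alpha_n)_{n\in\mathbb Z}$ be a $p$-periodic sequence in $\mathbb D$ that is not identically zero, and let $\alpha_{n,N}\in\mathbb D$ $(n,N\in\mathbb N_0)$ satisfy $$\lim_{kp/N\to t}\alpha_{kp+j,N}=\alpha_j\qquad\text{for all } j\in\{0,\dots,p-1\}.$$ For $j\in\mathbb N_0$ and $|\gamma|=1$ let $m_\gamma^{(j)}$ and $f_\gamma^{(j)}$ be the $m$-function and the Schur function of the CMV matrix with the coefficients $-\bar\alpha_{p-1-j}\gamma,\ -\bar\alpha_{p-2-j}\gamma,\ -\bar\alpha_{p-3-j}\gamma,\dots$ (the $j$ times stripped $p$-periodic CMV matrix $\mathcal C_\gamma$ with first coefficients $-\bar\alpha_{p-1}\gamma,\dots,-\bar\alpha_0\gamma$). Then for every $j\in\mathbb N_0$ the following limits hold; in each of them the denominators on the left have no zeros on the given compact set from some index on. 1. $\displaystyle\lim_{kp/N\to t}\frac{\Phi_{kp-j,N}(z)}{\Phi^{(\beta)}_{kp-j+1,N}(z)}=m_\beta^{(j)}(z)$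 uniformly on compacts of $\mathbb C\setminus\Lambda_{\beta,t}$. 2. $\displaystyle\lim_{kp/N\to t}\frac{\Phi_{kp-j,N}(z)}{\Phi^*_{kp-j,N}(z)}=f_1^{(j)}(z)$ uniformly on compacts of $\mathbb C\setminus(\Lambda_t\cup\mathcal P(f_1^{(j)}))$. 3. $\displaystyle\lim_{kp/N\to t}\frac{\Phi^*_{kp-j+1,N}(z)}{\Phi^*_{kp-j,N}(z)}=1-z\,\alpha_{p-j}f_1^{(j)}(z)$ uniformly on compacts of $\mathbb C\setminus(\Lambda_t\cup\mathcal P(f_1^{(j)}))$. 4. $\displaystyle\lim_{kp/N\to t}\frac{\Phi_{kp-j+1,N}(z)}{\Phi_{kp-j,N}(z)}=z-\bar\alpha_{p-j}/f_1^{(j)}(z)$ uniformly on compacts of $\mathbb C\setminus(\Lambda_t\cup\mathcal Z(f_1^{(j)}))$, where $1/\infty=0$. 5. $\displaystyle\lim_{kp/N\to t}\frac{\Phi^{(\beta)}_{kp-j+1,N}(z)}{\Phi^{(\beta)}_{kp-j,N}(z)}=L(z)$ uniformly on compacts of $\mathbb C\setminus\Lambda_{\beta,t}$, where $L$ is analytic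 on $\mathbb C\setminus\Lambda_{\beta,t}$ and $$L(z)=\frac{m_\beta^{(j+1)}(z)}{m_\beta^{(j)}(z)}\Bigl(z-\bar\alpha_{p-j-1}/f_1^{(j+1)}(z)\Bigr),\qquad z\in\mathbb C\setminus\bigl(\Lambda_{\beta,t}\cup\mathcal Z(f_1^{(j)})\cup\mathcal Z(f_1^{(j+1)})\bigr),$$ $$L(z)=\frac{\overline{m_\beta^{(j+1)}(1/\bar z)}}{\overline{m_\beta^{(j)}(1/\bar z)}}\Bigl(1-z\,\alpha_{p-j-1}f_1^{(j+1)}(z)\Bigr),\qquad z\in\mathbb C\setminus\bigl(\Lambda_{\beta,t}\cup\mathcal P(f_1^{(j)})\cup\mathcal P(f_1^{(j+1)})\cup\{0\}\bigr).$$ -/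

import Mathlib

open Filter Topology Polynomial
open scoped ComplexConjugate ENNReal

noncomputable section

/-! ### Limits along `n/N → t` -/

/-- The pairs of sequences with `n i, N i → ∞` and `n i / N i → t`. -/
def RatioSeq (t : ℝ) (n N : ℕ → ℕ) : Prop :=
  Tendsto n atTop atTop ∧ Tendsto N atTop atTop ∧
    Tendsto (fun i => (n i : ℝ) / (N i : ℝ)) atTop (𝓝 t)

/-! ### CMV matrices -/

/-- Verblunsky coefficients moved up by one place, with the convention `α_{-1} = -1`:
`cmvA α (n + 1) = α n`. -/
def cmvA (α : ℕ → ℂ) : ℕ → ℂ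
  | 0 => -1
  | n + 1 => α n

/-- `cmvR α (n + 1) = ρ_n = √(1 - |α_n|²)` and `cmvR α 0 = ρ_{-1} = 0`. -/
def cmvR (α : ℕ → ℂ) (n : ℕ) : ℂ := (Real.sqrt (1 - ‖cmvA α n‖ ^ 2) : ℝ)

/-- The entries of the (semi-infinite, five-diagonal) CMV matrix. Row `2k` is
`(…, ᾱ_{2k} ρ_{2k-1}, -ᾱ_{2k} α_{2k-1}, ᾱ_{2k+1} ρ_{2k}, ρ_{2k+1} ρ_{2k}, …)` in the columns
`2k-1, …, 2k+2`, and row `2k+1` is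
`(…, ρ_{2k} ρ_{2k-1}, -ρ_{2k} α_{2k-1}, -ᾱ_{2k+1} α_{2k}, -ρ_{2k+1} α_{2k}, …)` in the same
columns; for `k = 0` there is no column `-1`, and `α_{-1} = -1`. -/
def cmvMatrix (α : ℕ → ℂ) : Matrix ℕ ℕ ℂ := fun i j =>
  if Even i then
    if j + 1 = i then conj (cmvA α (i + 1)) * cmvR α i
    else if j = i then -conj (cmvA α (i + 1)) * cmvA α i
    else if j = i + 1 then conj (cmvA α (i + 2)) * cmvR α (i + 1)
    else if j = i + 2 then cmvR α (i + 2) * cmvR α (i + 1)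
    else 0
  else
    if j + 2 = i then cmvR α i * cmvR α (i - 1)
    else if j + 1 = i then -cmvR α i * cmvA α (i - 1)
    else if j = i then -conj (cmvA α (i + 1)) * cmvA α i
    else if j = i + 1 then -cmvR α (i + 1) * cmvA α i
    else 0

/-- The cut-off `𝒞_n`: the top-left `n × n` block of the CMV matrix. -/
def cmvCutoff (α : ℕ → ℂ) (n : ℕ) : Matrix (Fin n) (Fin n) ℂ :=
  (cmvMatrix α).submatrix (fun i => (i : ℕ)) (fun i => (i : ℕ))

/-- The Hilbert space `ℓ²(ℕ₀)`. -/
abbrev Ell2 : Type := lp (fun _ : ℕ => ℂ) 2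

theorem norm_cmvA_le {α : ℕ → ℂ} (h : ∀ n, ‖α n‖ ≤ 1) (n : ℕ) : ‖cmvA α n‖ ≤ 1 := by
  cases n with
  | zero => simp [cmvA]
  | succ n => exact h n

theorem norm_cmvR_le (α : ℕ → ℂ) (n : ℕ) : ‖cmvR α n‖ ≤ 1 := by
  rw [cmvR, Complex.norm_real, Real.norm_of_nonneg (Real.sqrt_nonneg _)]
  exact Real.sqrt_le_iff.2 ⟨zero_le_one, by nlinarith [sq_nonneg ‖cmvA α n‖]⟩

theorem norm_cmvMatrix_le {α : ℕ → ℂ} (h : ∀ n, ‖α n‖ ≤ 1) (i j : ℕ) :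
    ‖cmvMatrix α i j‖ ≤ 1 := by
  have hA := norm_cmvA_le h
  have hR := norm_cmvR_le α
  have key : ∀ {x y : ℝ}, 0 ≤ y → x ≤ 1 → y ≤ 1 → x * y ≤ 1 := fun hy hx hy1 =>
    mul_le_one₀ hx hy hy1
  unfold cmvMatrix
  split_ifs <;> simp only [norm_mul, norm_neg, RCLike.norm_conj, norm_zero, zero_le_one] <;>
    exact key (norm_nonneg _) (by first | exact hA _ | exact hR _)
      (by first | exact hA _ | exact hR _)

theorem cmvMatrix_eq_zero (α : ℕ → ℂ) {i j : ℕ} (h : j + 2 < i ∨ i + 2 < j) :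
    cmvMatrix α i j = 0 := by
  unfold cmvMatrix
  split_ifs <;> first | rfl | omega

/-- The action of the CMV matrix on a sequence (a finite sum, as row `i` vanishes beyond
column `i + 2`). -/
def cmvAct (α : ℕ → ℂ) (x : ℕ → ℂ) (i : ℕ) : ℂ :=
  ∑ j ∈ Finset.range (i + 3), cmvMatrix α i j * x j

/-- Auxiliary: the moduli of `x`, shifted by two places. -/
def shiftTwo (x : ℕ → ℂ) (n : ℕ) : ℝ := if n < 2 then 0 else ‖x (n - 2)‖

theorem norm_cmvAct_le {α : ℕ → ℂ} (h : ∀ n, ‖α n‖ ≤ 1) (x : ℕ → ℂ) (i : ℕ) :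
    ‖cmvAct α x i‖ ≤ ∑ d ∈ Finset.range 5, shiftTwo x (i + d) := by
  have h1 : ‖cmvAct α x i‖ ≤ ∑ j ∈ Finset.range (i + 3), if i ≤ j + 2 then ‖x j‖ else 0 := by
    refine (norm_sum_le _ _).trans (Finset.sum_le_sum fun j _ => ?_)
    split_ifs with hj
    · rw [norm_mul]
      exact mul_le_of_le_one_left (norm_nonneg _) (norm_cmvMatrix_le h i j)
    · rw [cmvMatrix_eq_zero α (Or.inl (by omega))]; simp
  have h2 : ∑ j ∈ Finset.range (i + 3), (if i ≤ j + 2 then ‖x j‖ else 0)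
      ≤ ∑ m ∈ Finset.range (i + 5), if i ≤ m then shiftTwo x m else 0 := by
    rw [Finset.sum_range_succ' (n := i + 4), Finset.sum_range_succ' (n := i + 3)]
    have : ∑ j ∈ Finset.range (i + 3), (if i ≤ j + 2 then ‖x j‖ else 0)
        = ∑ k ∈ Finset.range (i + 3), if i ≤ k + 1 + 1 then shiftTwo x (k + 1 + 1) else 0 := by
      refine Finset.sum_congr rfl fun j _ => ?_
      simp [shiftTwo]
    rw [this]
    have n1 : 0 ≤ (if i ≤ 0 + 1 then shiftTwo x (0 + 1) else 0) := by
      split_ifs <;> simp [shiftTwo]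
    have n2 : 0 ≤ (if i ≤ 0 then shiftTwo x 0 else 0) := by
      split_ifs <;> simp [shiftTwo]
    linarith
  have h3 : ∑ m ∈ Finset.range (i + 5), (if i ≤ m then shiftTwo x m else 0)
      = ∑ d ∈ Finset.range 5, shiftTwo x (i + d) := by
    rw [Finset.sum_range_add]
    have : ∑ m ∈ Finset.range i, (if i ≤ m then shiftTwo x m else 0) = 0 :=
      Finset.sum_eq_zero fun m hm => by
        have := Finset.mem_range.1 hm
        rw [if_neg (by omega)]
    rw [this, zero_add]
    exact Finset.sum_congr rfl fun d _ => by rw [if_pos (by omega)]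
  exact h1.trans (h2.trans h3.le)

theorem summable_sq (x : Ell2) : Summable fun i => ‖x i‖ ^ 2 := by
  have := (memℓp_gen_iff (p := 2) (by norm_num)).1 (lp.memℓp x)
  simpa using this

theorem hasSum_shiftTwo_sq (x : Ell2) : HasSum (fun n => shiftTwo x n ^ 2) (‖x‖ ^ 2) := by
  have h : HasSum (fun n => ‖x n‖ ^ 2) (‖x‖ ^ 2) := by
    have := lp.hasSum_norm (p := 2) (by norm_num) x
    simpa using this
  rw [← hasSum_nat_add_iff' 2]
  simpa [shiftTwo, Finset.sum_range_succ] using h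

theorem sq_cmvAct_le {α : ℕ → ℂ} (h : ∀ n, ‖α n‖ ≤ 1) (x : ℕ → ℂ) (i : ℕ) :
    ‖cmvAct α x i‖ ^ 2 ≤ 5 * ∑ d ∈ Finset.range 5, shiftTwo x (i + d) ^ 2 := by
  have h1 := norm_cmvAct_le h x i
  have h2 : (∑ d ∈ Finset.range 5, shiftTwo x (i + d)) ^ 2
      ≤ 5 * ∑ d ∈ Finset.range 5, shiftTwo x (i + d) ^ 2 := by
    simpa using sq_sum_le_card_mul_sum_sq (s := Finset.range 5)
      (f := fun d => shiftTwo x (i + d))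
  exact (pow_le_pow_left₀ (norm_nonneg _) h1 2).trans h2

theorem summable_shiftTwo_bound (x : Ell2) :
    Summable fun i => 5 * ∑ d ∈ Finset.range 5, shiftTwo x (i + d) ^ 2 :=
  (summable_sum fun d _ =>
    (summable_nat_add_iff d).2 (hasSum_shiftTwo_sq x).summable).mul_left 5

theorem memlp_cmvAct {α : ℕ → ℂ} (h : ∀ n, ‖α n‖ ≤ 1) (x : Ell2) :
    Memℓp (E := fun _ : ℕ => ℂ) (cmvAct α x) 2 := by
  refine memℓp_gen ?_
  simp only [ENNReal.toReal_ofNat, Real.rpow_ofNat]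
  exact (summable_shiftTwo_bound x).of_nonneg_of_le (fun i => by positivity)
    (fun i => sq_cmvAct_le h x i)

theorem norm_cmvAct_lp_le {α : ℕ → ℂ} (h : ∀ n, ‖α n‖ ≤ 1) (x : Ell2) :
    ‖(⟨cmvAct α x, memlp_cmvAct h x⟩ : Ell2)‖ ≤ 5 * ‖x‖ := by
  have hs : HasSum (fun n => ‖cmvAct α x n‖ ^ 2)
      (‖(⟨cmvAct α x, memlp_cmvAct h x⟩ : Ell2)‖ ^ 2) := by
    have := lp.hasSum_norm (p := 2) (by norm_num) (⟨cmvAct α x, memlp_cmvAct h x⟩ : Ell2)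
    simpa using this
  have hb : ∑' i, (5 * ∑ d ∈ Finset.range 5, shiftTwo x (i + d) ^ 2) ≤ 25 * ‖x‖ ^ 2 := by
    have hx := hasSum_shiftTwo_sq x
    rw [tsum_mul_left, Summable.tsum_finsetSum fun d _ => (summable_nat_add_iff d).2 hx.summable]
    have : ∀ d ∈ Finset.range 5, ∑' i, shiftTwo x (i + d) ^ 2 ≤ ‖x‖ ^ 2 := fun d _ => by
      have h1 := hx.summable.sum_add_tsum_nat_add d
      rw [hx.tsum_eq] at h1
      have h2 : 0 ≤ ∑ i ∈ Finset.range d, shiftTwo x i ^ 2 :=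
        Finset.sum_nonneg fun i _ => sq_nonneg _
      linarith
    have h3 := Finset.sum_le_sum this
    simp only [Finset.sum_const, Finset.card_range, nsmul_eq_mul, Nat.cast_ofNat] at h3
    linarith
  have h4 : ‖(⟨cmvAct α x, memlp_cmvAct h x⟩ : Ell2)‖ ^ 2 ≤ (5 * ‖x‖) ^ 2 := by
    have h5 := hasSum_le (fun i => sq_cmvAct_le h x i) hs (summable_shiftTwo_bound x).hasSum
    nlinarith
  exact (pow_le_pow_iff_left₀ (norm_nonneg _) (by positivity) two_ne_zero).1 h4

open Classical in
/-- The CMV operator on `ℓ²(ℕ₀)`: the bounded operator given by the CMV matrix, for coefficients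
in the closed unit disk (and `0` for other sequences, which never occur). -/
def cmvOperator (α : ℕ → ℂ) : Ell2 →L[ℂ] Ell2 :=
  if h : ∀ n, ‖α n‖ ≤ 1 then
    LinearMap.mkContinuous
      { toFun := fun x => ⟨cmvAct α x, memlp_cmvAct h x⟩
        map_add' := fun x y => by
          ext i
          change cmvAct α (x + y : Ell2) i = cmvAct α x i + cmvAct α y i
          simp [cmvAct, mul_add, Finset.sum_add_distrib]
        map_smul' := fun c x => by
          ext i
          change cmvAct α (c • x : Ell2) i = c * cmvAct α x i
          simp [cmvAct, Finset.mul_sum, mul_left_comm] }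
      5 (norm_cmvAct_lp_le h)
  else 0

theorem cmvOperator_apply {α : ℕ → ℂ} (h : ∀ n, ‖α n‖ ≤ 1) (x : Ell2) (i : ℕ) :
    cmvOperator α x i = ∑ j ∈ Finset.range (i + 3), cmvMatrix α i j * x j := by
  simp [cmvOperator, h, cmvAct]

/-! ### Orthogonal and paraorthogonal polynomials -/

/-- The monic OPUC `Φ_n(z) = det(z - 𝒞_n)` with Verblunsky coefficients `α`. -/
def opuc (α : ℕ → ℂ) (n : ℕ) : ℂ[X] := (cmvCutoff α n).charpoly

/-- The reversed polynomial `Φ_n^*(z) = z^n conj(Φ_n(1/z̄))`: the coefficients of `Φ_n`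
(which has degree `n`) are conjugated and their order is reversed. -/
def opucStar (α : ℕ → ℂ) (n : ℕ) : ℂ[X] := ((opuc α n).map (starRingEnd ℂ)).reflect n

/-- The POPUC `Φ_n^{(β)}(z) = det(z - 𝒞_n(α_0, …, α_{n-2}, β))`. -/
def popuc (β : ℂ) (α : ℕ → ℂ) (n : ℕ) : ℂ[X] :=
  (cmvCutoff (Function.update α (n - 1) β) n).charpoly

/-! ### Carathéodory, Schur and `m`-functions -/

/-- The vector `e_0`. -/
def vecE0 : Ell2 := lp.single 2 0 (1 : ℂ)

/-- `m(z) = ⟨e_0, (z - 𝒞)⁻¹ e_0⟩`. -/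
def mFun (α : ℕ → ℂ) (z : ℂ) : ℂ :=
  inner ℂ vecE0 (resolvent (cmvOperator α) z vecE0)

/-- `F(z) = ⟨e_0, (𝒞 + z)(𝒞 - z)⁻¹ e_0⟩`. -/
def caraFun (α : ℕ → ℂ) (z : ℂ) : ℂ :=
  inner ℂ vecE0 (((cmvOperator α + algebraMap ℂ (Ell2 →L[ℂ] Ell2) z) *
    Ring.inverse (cmvOperator α - algebraMap ℂ (Ell2 →L[ℂ] Ell2) z)) vecE0)

open Classical in
/-- `(1/z) (F(z) - 1) / (F(z) + 1)`, with the value `∞` where `F(z) = -1`. -/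
def schurQuot (α : ℕ → ℂ) (z : ℂ) : OnePoint ℂ :=
  if caraFun α z = -1 then OnePoint.infty
  else ((1 / z * ((caraFun α z - 1) / (caraFun α z + 1)) : ℂ) : OnePoint ℂ)

open Classical in
/-- The Schur function, with values in `ℂ ∪ {∞}`: off the spectrum of the CMV operator and for
`z ≠ 0` it is `(1/z) (F(z) - 1) / (F(z) + 1)`; at the other points it is the limit of this
expression, where the limit exists (this concerns `z = 0` and the isolated point masses of the
spectral measure). -/
def schurFun (α : ℕ → ℂ) (z : ℂ) : OnePoint ℂ :=
  if z ∈ resolventSet ℂ (cmvOperator α) \ {0} then schurQuot α z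
  else limUnder (𝓝[resolventSet ℂ (cmvOperator α) \ {0}] z) (schurQuot α)

/-- The value of a point of `ℂ ∪ {∞}` as a complex number (`0` for the point `∞`). -/
def finVal : OnePoint ℂ → ℂ
  | OnePoint.some w => w
  | OnePoint.infty => 0

/-- The reciprocal `1/w` for `w ∈ ℂ ∪ {∞}`, `w ≠ 0`, with `1/∞ = 0`. -/
def recipVal : OnePoint ℂ → ℂ
  | OnePoint.some w => w⁻¹
  | OnePoint.infty => 0

/-- Zeros in the open unit disk. -/
def zeroSet (f : ℂ → OnePoint ℂ) : Set ℂ := {z | ‖z‖ < 1 ∧ f z = ((0 : ℂ) : OnePoint ℂ)}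

/-- Poles outside of the closed unit disk. -/
def poleSet (f : ℂ → OnePoint ℂ) : Set ℂ := {z | 1 < ‖z‖ ∧ f z = OnePoint.infty}

/-! ### Limit points of zeros of POPUC -/

/-- The zeros of `Φ_n^{(β)}` on the unit circle. -/
def popucZeros (β : ℂ) (α : ℕ → ℂ) (n : ℕ) : Set ℂ :=
  {z | ‖z‖ = 1 ∧ (popuc β α n).eval z = 0}

/-- `Λ_{β,t}` for the doubly indexed coefficients `α n N`. -/
def limZeros (α : ℕ → ℕ → ℂ) (β : ℂ) (t : ℝ) : Set ℂ :=
  {z | ‖z‖ = 1 ∧ ∃ n N : ℕ → ℕ, RatioSeq t n N ∧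
    liminf (fun i => Metric.infEDist z (popucZeros β (fun l => α l (N i)) (n i))) atTop = 0}

/-- `Λ_t`, the intersection of all `Λ_{β,t}` with `|β| = 1`. -/
def limZerosAll (α : ℕ → ℕ → ℂ) (t : ℝ) : Set ℂ :=
  {z | ∀ β : ℂ, ‖β‖ = 1 → z ∈ limZeros α β t}

/-! ### The periodic limit matrices -/

/-- The Verblunsky coefficients `-ᾱ_{p-1} β, -ᾱ_{p-2} β, …` of `𝒞_β`, stripped `j` times. -/
def revCoeff (p : ℕ) (a : ℤ → ℂ) (β : ℂ) (j : ℕ) : ℕ → ℂ :=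
  fun n => -conj (a ((p : ℤ) - 1 - ((n + j : ℕ) : ℤ))) * β

/-- `num k N / den k N → L` as `k p / N → t`, uniformly on the compact subsets of `U`; the
denominators have no zeros on the compact set from some index on. -/
def RatioLimit (p : ℕ) (t : ℝ) (num den : ℕ → ℕ → ℂ[X]) (L : ℂ → ℂ) (U : Set ℂ) : Prop :=
  ∀ k N : ℕ → ℕ, RatioSeq t (fun i => k i * p) N → ∀ K ⊆ U, IsCompact K →
    (∀ᶠ i in atTop, ∀ z ∈ K, (den (k i) (N i)).eval z ≠ 0) ∧
    TendstoUniformlyOn (fun i z => (num (k i) (N i)).eval z / (den (k i) (N i)).eval z) L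
      atTop K

end

/-! The proof reverses a finite CMV matrix. The POPUC of degree n + 1 is the characteristic
polynomial of a unitary CMV cut-off with last coefficient β, and Φ_n is that of the same matrix
without its last row and column. Reversing the order of the indices gives, up to a diagonal
conjugation and possibly a transposition, the finite CMV matrix with coefficients -ᾱ_{n-1}β, …,
-ᾱ_0β, β (`det_sub_cutoff_revSeq`). The deleted index becomes the first one, so by Cramer's rule Φ_n
divided by the POPUC is the m-function of the reversed matrix (`exists_reversed_cmvOperator`).

As kp/N → t with n = kp - j, each coefficient of the reversed matrix converges to the corresponding
coefficient of the j times stripped periodic matrix. Hence the CMV operators converge strongly. They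
are unitary and the spectra of the approximants consist of zeros of the POPUC, which keep a positive
distance from every point outside Λ_{β,t}; so the resolvents converge there, locally uniformly in z
(`tendsto_inner_resolvent`, `tendsto_opuc_div_popuc`). This is the first limit.

The rest is algebra with the Szegő recursion (`opuc_succ`, `opucStar_succ`, `popuc_succ`). The POPUC
is zΦ_n - β̄Φ_n^*, so Φ_n/Φ_n^* converges to β̄ m_β/(z m_β - 1). The left side does not involve β;
comparison with β = 1 identifies this expression with the Schur function f_1
(`PeriodicLimit.schurFun_eq`), and any admissible β may be used at a given point, whence the set
Λ_t. The identity 2 Re(z m) = 1 + (|z|² - 1)‖(z - 𝒞)⁻¹e_0‖² confines the zeros of m to the open disk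
and the solutions of z m = 1 to its exterior, which is why only 𝒵(f) and 𝒫(f) have to be removed.
The fifth limit has two formulas, through Φ_n and through Φ_n^*; at least one of them is available
at each point. -/

/-! ### Unitarity of the CMV operator -/

/-- Rotation of the consecutive pairs `(v n, v (n + 1))`, `n ≡ s mod 2`, of a sequence of vectors
by the unitary matrices built from `A (n + 1)` and `R (n + 1)`. -/
noncomputable def pairRotation {E : Type*} [AddCommGroup E] [Module ℂ E] (A R : ℕ → ℂ) (s : ℕ)
    (v : ℕ → E) (n : ℕ) : E :=
  if n % 2 = s then conj (A (n + 1)) • v n + R (n + 1) • v (n + 1)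
  else R n • v (n - 1) - A n • v n

/-- Compatibility of the two sequences of parameters of the rotations. -/
structure RotationData (A R : ℕ → ℂ) : Prop where
  conj_R : ∀ n, conj (R n) = R n
  sq_add : ∀ n, A n * conj (A n) + R n * R n = 1
  A_zero : A 0 = -1
  R_zero : R 0 = 0

theorem rotationData_cmv {α : ℕ → ℂ} (h : ∀ n, ‖α n‖ ≤ 1) : RotationData (cmvA α) (cmvR α) where
  conj_R n := by simp [cmvR]
  sq_add n := by
    have h1 : ‖cmvA α n‖ ^ 2 ≤ 1 := pow_le_one₀ (norm_nonneg _) (norm_cmvA_le h n)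
    rw [Complex.mul_conj, cmvR, ← Complex.ofReal_mul, Real.mul_self_sqrt (by linarith),
      Complex.normSq_eq_norm_sq]
    push_cast; ring
  A_zero := rfl
  R_zero := by simp [cmvR, cmvA]

/-- Each pair is transformed by the unitary block with rows (Ā, R) and (R, -A), and different pairs
involve different vectors. For s = 1 the vector of index 0 has no partner and stays fixed, as A 0 =
-1; since R 0 = 0, the truncated difference n - 1 at n = 0 is harmless. -/
theorem pairRotation_orthonormal {E : Type*} [NormedAddCommGroup E] [InnerProductSpace ℂ E]
    {A R : ℕ → ℂ} (h : RotationData A R) {s : ℕ} (hs : s < 2) {v : ℕ → E}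
    (hv : Orthonormal ℂ v) : Orthonormal ℂ (pairRotation A R s v) := by
  rw [orthonormal_iff_ite] at hv ⊢
  intro m n
  have hm := h.sq_add m
  have hm' := h.sq_add (m + 1)
  have h0 := h.R_zero
  have h0' := h.A_zero
  unfold pairRotation
  split_ifs with h1 h2 h3 h2 h3 <;>
  simp only [inner_add_left, inner_sub_left, inner_add_right, inner_sub_right, inner_smul_left,
    inner_smul_right, hv, h.conj_R, Complex.conj_conj]
  · subst h3
    rw [if_pos rfl, if_neg (by omega), if_neg (by omega), if_pos rfl]
    linear_combination hm'
  · rw [if_neg (by omega), if_neg (by omega), if_neg (by omega), if_neg (by omega)]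
    ring
  · omega
  · by_cases h4 : m + 1 = n
    · subst h4
      rw [if_pos (by omega), if_neg (by omega), if_neg (by omega), if_pos (by omega)]
      ring
    · rcases Nat.eq_zero_or_pos n with rfl | hn
      · rw [if_neg (by omega), if_neg (by omega), h0]; simp
      · rw [if_neg (by omega), if_neg (by omega), if_neg (by omega), if_neg (by omega)]
        ring
  · omega
  · by_cases h4 : n + 1 = m
    · subst h4
      rw [if_pos (by omega), if_neg (by omega), if_neg (by omega), if_pos (by omega)]
      ring
    · rcases Nat.eq_zero_or_pos m with rfl | hn
      · rw [if_neg (by omega), if_neg (by omega), h0]; simp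
      · rw [if_neg (by omega), if_neg (by omega), if_neg (by omega), if_neg (by omega)]
        ring
  · rename_i h3
    subst h3
    rcases Nat.eq_zero_or_pos m with rfl | hn
    · simp [h0, h0']
    · rw [if_pos rfl, if_neg (by omega), if_neg (by omega), if_pos rfl]
      linear_combination hm
  · rename_i h3
    rcases Nat.eq_zero_or_pos m with rfl | hm
    · rcases Nat.eq_zero_or_pos n with rfl | hn
      · omega
      · rw [if_neg (by omega), if_neg (by omega), h0]; simp
    · rcases Nat.eq_zero_or_pos n with rfl | hn
      · rw [if_neg (by omega), if_neg (by omega), h0]; simp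
      · rw [if_neg (by omega), if_neg (by omega), if_neg (by omega), if_neg (by omega)]
        ring

/-- The inverse of a block is its conjugate transpose, so the old vectors are recovered within each
pair. -/
theorem mem_span_pairRotation {E : Type*} [AddCommGroup E] [Module ℂ E]
    {A R : ℕ → ℂ} (h : RotationData A R) {s : ℕ} (hs : s < 2) (v : ℕ → E) (n : ℕ) :
    v n ∈ Submodule.span ℂ (Set.range (pairRotation A R s v)) := by
  have hmem (m : ℕ) : pairRotation A R s v m ∈ Submodule.span ℂ
      (Set.range (pairRotation A R s v)) := Submodule.subset_span ⟨m, rfl⟩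
  by_cases hn : n % 2 = s
  · have : v n = A (n + 1) • pairRotation A R s v n + R (n + 1) • pairRotation A R s v (n + 1) := by
      rw [pairRotation, if_pos hn, pairRotation, if_neg (by omega), Nat.add_sub_cancel]
      have := h.sq_add (n + 1)
      calc v n = (1 : ℂ) • v n := (one_smul _ _).symm
        _ = _ := by rw [← this]; module
    rw [this]
    exact add_mem (Submodule.smul_mem _ _ (hmem _)) (Submodule.smul_mem _ _ (hmem _))
  · rcases n with _ | n
    · have : v 0 = pairRotation A R s v 0 := by
        rw [pairRotation, if_neg hn, h.R_zero, h.A_zero]; simp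
      rw [this]; exact hmem 0
    · have : v (n + 1) = R (n + 1) • pairRotation A R s v n
          - conj (A (n + 1)) • pairRotation A R s v (n + 1) := by
        rw [pairRotation, if_pos (by omega), pairRotation, if_neg hn, Nat.add_sub_cancel]
        have := h.sq_add (n + 1)
        calc v (n + 1) = (1 : ℂ) • v (n + 1) := (one_smul _ _).symm
          _ = _ := by rw [← this]; module
      rw [this]
      exact sub_mem (Submodule.smul_mem _ _ (hmem _)) (Submodule.smul_mem _ _ (hmem _))

theorem span_le_span_pairRotation {E : Type*} [AddCommGroup E] [Module ℂ E]
    {A R : ℕ → ℂ} (h : RotationData A R) {s : ℕ} (hs : s < 2) (v : ℕ → E) :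
    Submodule.span ℂ (Set.range v) ≤ Submodule.span ℂ (Set.range (pairRotation A R s v)) := by
  rw [Submodule.span_le]
  rintro _ ⟨n, rfl⟩
  exact mem_span_pairRotation h hs v n

/-- The standard basis of `ℓ²(ℕ₀)`. -/
noncomputable def ell2Basis : HilbertBasis ℕ ℂ Ell2 := .ofRepr (.refl ℂ Ell2)

theorem ell2Basis_apply (i : ℕ) : ell2Basis i = lp.single 2 i (1 : ℂ) := by
  classical
  rw [← ell2Basis.repr_symm_single i]; rfl

theorem ell2Basis_coord (i j : ℕ) : (ell2Basis i : Ell2) j = if j = i then 1 else 0 := by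
  rw [ell2Basis_apply, lp.single_apply]
  simp [Pi.single_apply]

theorem cmvOperator_basis_apply {α : ℕ → ℂ} (h : ∀ n, ‖α n‖ ≤ 1) (j i : ℕ) :
    cmvOperator α (ell2Basis j) i = cmvMatrix α i j := by
  rw [cmvOperator_apply h]
  simp only [ell2Basis_coord, mul_ite, mul_one, mul_zero, Finset.sum_ite_eq', Finset.mem_range]
  split_ifs with hj
  · rfl
  · rw [cmvMatrix_eq_zero]; omega

theorem cmvMatrix_even (α : ℕ → ℂ) (k j : ℕ) : cmvMatrix α (2 * k) j =
    if j + 1 = 2 * k then conj (cmvA α (2 * k + 1)) * cmvR α (2 * k)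
    else if j = 2 * k then -conj (cmvA α (2 * k + 1)) * cmvA α (2 * k)
    else if j = 2 * k + 1 then conj (cmvA α (2 * k + 2)) * cmvR α (2 * k + 1)
    else if j = 2 * k + 2 then cmvR α (2 * k + 2) * cmvR α (2 * k + 1)
    else 0 := by
  rw [cmvMatrix, if_pos (even_two_mul k)]

theorem cmvMatrix_odd (α : ℕ → ℂ) (k j : ℕ) : cmvMatrix α (2 * k + 1) j =
    if j + 1 = 2 * k then cmvR α (2 * k + 1) * cmvR α (2 * k)
    else if j = 2 * k then -cmvR α (2 * k + 1) * cmvA α (2 * k)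
    else if j = 2 * k + 1 then -conj (cmvA α (2 * k + 2)) * cmvA α (2 * k + 1)
    else if j = 2 * k + 2 then -cmvR α (2 * k + 2) * cmvA α (2 * k + 1)
    else 0 := by
  rw [cmvMatrix, if_neg (by simp)]
  simp only [Nat.add_sub_cancel, add_left_inj, show j + 2 = 2 * k + 1 ↔ j + 1 = 2 * k by omega]

/-- This is the factorization 𝒞 = 𝓛ℳ on basis vectors. The inner rotation produces 𝓛e_k; the outer
one combines these vectors with the entries of column j of ℳ, which is also its row j because ℳ is
symmetric. -/
theorem cmvOperator_basis {α : ℕ → ℂ} (h : ∀ n, ‖α n‖ ≤ 1) (j : ℕ) :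
    cmvOperator α (ell2Basis j) = pairRotation (cmvA α) (cmvR α) 1
      (pairRotation (cmvA α) (cmvR α) 0 fun i => ell2Basis i) j := by
  have hR : cmvR α 0 = 0 := (rotationData_cmv h).R_zero
  ext i
  rw [cmvOperator_basis_apply h]
  rcases Nat.even_or_odd' j with ⟨k, rfl | rfl⟩
  · rcases k with _ | k
    · simp only [pairRotation, mul_zero, Nat.zero_mod, zero_ne_one, if_false, if_true, hR]
      simp only [zero_smul, zero_sub, lp.coeFn_neg, lp.coeFn_add, lp.coeFn_smul, Pi.neg_apply,
        Pi.add_apply, Pi.smul_apply, ell2Basis_coord, smul_eq_mul]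
      rcases Nat.even_or_odd' i with ⟨l, rfl | rfl⟩
      · rw [cmvMatrix_even]
        grind
      · rw [cmvMatrix_odd]
        grind
    · rw [pairRotation, if_neg (by omega), pairRotation, if_neg (by omega), pairRotation,
        if_pos (by omega), show 2 * (k + 1) - 1 - 1 = 2 * k by omega,
        show 2 * (k + 1) - 1 = 2 * k + 1 by omega]
      simp only [lp.coeFn_sub, lp.coeFn_add, lp.coeFn_smul, Pi.sub_apply,
        Pi.add_apply, Pi.smul_apply, ell2Basis_coord, smul_eq_mul]
      rcases Nat.even_or_odd' i with ⟨l, rfl | rfl⟩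
      · rw [cmvMatrix_even]
        grind
      · rw [cmvMatrix_odd]
        grind
  · rw [pairRotation, if_pos (by omega), pairRotation, if_neg (by omega), pairRotation,
        if_pos (by omega), Nat.add_sub_cancel]
    simp only [lp.coeFn_sub, lp.coeFn_add, lp.coeFn_smul, Pi.sub_apply,
      Pi.add_apply, Pi.smul_apply, ell2Basis_coord, smul_eq_mul]
    rcases Nat.even_or_odd' i with ⟨l, rfl | rfl⟩
    · rw [cmvMatrix_even]
      grind
    · rw [cmvMatrix_odd]
      grind

/-- The CMV operator as an isometric automorphism of `ℓ²(ℕ₀)`. -/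
theorem cmvOperator_eq_linearIsometryEquiv {α : ℕ → ℂ} (h : ∀ n, ‖α n‖ ≤ 1) :
    ∃ e : Ell2 ≃ₗᵢ[ℂ] Ell2, ∀ x, cmvOperator α x = e x := by
  classical
  have hd := rotationData_cmv h
  have ho := pairRotation_orthonormal hd one_lt_two
    (pairRotation_orthonormal hd zero_lt_two ell2Basis.orthonormal)
  have hs := ell2Basis.dense_span.ge.trans (Submodule.topologicalClosure_mono
    ((span_le_span_pairRotation hd zero_lt_two ell2Basis).trans
      (span_le_span_pairRotation hd one_lt_two _)))
  obtain ⟨e, he⟩ : ∃ e : Ell2 ≃ₗᵢ[ℂ] Ell2,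
      ∀ j, e (ell2Basis j) = cmvOperator α (ell2Basis j) := by
    -- The images of the basis vectors form a Hilbert basis, and the inverse of its coordinate map
    -- sends each basis vector to its image.
    refine ⟨(HilbertBasis.mk ho hs).repr.symm, fun j => ?_⟩
    rw [cmvOperator_basis h, ell2Basis_apply, HilbertBasis.repr_symm_single]
    exact congrFun (HilbertBasis.coe_mk ho hs) j
  have hdense : Dense (Submodule.span ℂ (Set.range ell2Basis) : Set Ell2) := by
    rw [Submodule.dense_iff_topologicalClosure_eq_top]
    exact ell2Basis.dense_span
  have : Set.EqOn (cmvOperator α) (e : Ell2 →L[ℂ] Ell2) (Set.range ell2Basis) := by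
    rintro _ ⟨j, rfl⟩
    exact (he j).symm
  exact ⟨e, DFunLike.congr_fun (ContinuousLinearMap.ext_on hdense this)⟩

theorem norm_cmvOperator_apply {α : ℕ → ℂ} (h : ∀ n, ‖α n‖ ≤ 1) (x : Ell2) :
    ‖cmvOperator α x‖ = ‖x‖ := by
  obtain ⟨e, he⟩ := cmvOperator_eq_linearIsometryEquiv h
  rw [he, e.norm_map]

theorem cmvOperator_mem_unitary {α : ℕ → ℂ} (h : ∀ n, ‖α n‖ ≤ 1) :
    cmvOperator α ∈ unitary (Ell2 →L[ℂ] Ell2) := by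
  obtain ⟨e, he⟩ := cmvOperator_eq_linearIsometryEquiv h
  have : cmvOperator α = (e : Ell2 →L[ℂ] Ell2) := ContinuousLinearMap.ext he
  rw [this]
  exact (Unitary.linearIsometryEquiv.symm e).2

/-- Convergence of the coefficients implies strong convergence of the CMV operators. -/
theorem tendsto_cmvOperator_apply {ι : Type*} {l : Filter ι} {γ : ι → ℕ → ℂ} {γ' : ℕ → ℂ}
    (h : ∀ i n, ‖γ i n‖ ≤ 1) (h' : ∀ n, ‖γ' n‖ ≤ 1)
    (hlim : ∀ n, Tendsto (fun i => γ i n) l (𝓝 (γ' n))) (x : Ell2) :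
    Tendsto (fun i => cmvOperator (γ i) x) l (𝓝 (cmvOperator γ' x)) := by
  have hA (n : ℕ) : Tendsto (fun i => cmvA (γ i) n) l (𝓝 (cmvA γ' n)) := by
    cases n with
    | zero => exact tendsto_const_nhds
    | succ n => exact hlim n
  have hR (n : ℕ) : Tendsto (fun i => cmvR (γ i) n) l (𝓝 (cmvR γ' n)) :=
    (Complex.continuous_ofReal.tendsto _).comp ((Real.continuous_sqrt.tendsto _).comp
      (((hA n).norm.pow 2).const_sub 1))
  have hcA (n : ℕ) : Tendsto (fun i => conj (cmvA (γ i) n)) l (𝓝 (conj (cmvA γ' n))) :=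
    (Complex.continuous_conj.tendsto _).comp (hA n)
  have hrot (s : ℕ) (v : ι → ℕ → Ell2) (v' : ℕ → Ell2)
      (hv : ∀ n, Tendsto (fun i => v i n) l (𝓝 (v' n))) (n : ℕ) :
      Tendsto (fun i => pairRotation (cmvA (γ i)) (cmvR (γ i)) s (v i) n) l
        (𝓝 (pairRotation (cmvA γ') (cmvR γ') s v' n)) := by
    unfold pairRotation
    split_ifs
    · exact ((hcA _).smul (hv _)).add ((hR _).smul (hv _))
    · exact ((hR _).smul (hv _)).sub ((hA _).smul (hv _))
  have hbasis (n : ℕ) : Tendsto (fun i => cmvOperator (γ i) (ell2Basis n)) l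
      (𝓝 (cmvOperator γ' (ell2Basis n))) := by
    rw [cmvOperator_basis h']
    have h0 := hrot 0 (fun _ n => ell2Basis n) (fun n => ell2Basis n) fun _ => tendsto_const_nhds
    refine (hrot 1 (fun i => pairRotation (cmvA (γ i)) (cmvR (γ i)) 0 fun n => ell2Basis n)
      _ h0 n).congr fun i => ?_
    rw [cmvOperator_basis (h i)]
  have hspan : ∀ y ∈ Submodule.span ℂ (Set.range ell2Basis),
      Tendsto (fun i => cmvOperator (γ i) y) l (𝓝 (cmvOperator γ' y)) := by
    intro y hy
    induction hy using Submodule.span_induction with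
    | mem y hy => obtain ⟨n, rfl⟩ := hy; exact hbasis n
    | zero => simpa using tendsto_const_nhds
    | add y z _ _ hy hz => simpa using hy.add hz
    | smul c y _ hy => simpa using hy.const_smul c
  rw [Metric.tendsto_nhds]
  intro ε hε
  have hx : x ∈ closure (Submodule.span ℂ (Set.range ell2Basis) : Set Ell2) := by
    rw [← Submodule.topologicalClosure_coe, ell2Basis.dense_span]; trivial
  obtain ⟨y, hy, hxy⟩ := Metric.mem_closure_iff.1 hx (ε / 3) (by positivity)
  filter_upwards [Metric.tendsto_nhds.1 (hspan y hy) (ε / 3) (by positivity)] with i hi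
  -- All operators involved are isometries, so convergence on the dense span extends to all vectors
  -- by an ε/3 argument.
  have hd {δ : ℕ → ℂ} (hδ : ∀ n, ‖δ n‖ ≤ 1) (u v : Ell2) :
      dist (cmvOperator δ u) (cmvOperator δ v) = dist u v := by
    rw [dist_eq_norm, ← map_sub, norm_cmvOperator_apply hδ, dist_eq_norm]
  calc dist (cmvOperator (γ i) x) (cmvOperator γ' x)
      ≤ dist (cmvOperator (γ i) x) (cmvOperator (γ i) y)
        + dist (cmvOperator (γ i) y) (cmvOperator γ' y)
        + dist (cmvOperator γ' y) (cmvOperator γ' x) := dist_triangle4 _ _ _ _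
    _ < ε / 3 + ε / 3 + ε / 3 := by
        rw [hd (h i), hd h', dist_comm y x]
        gcongr
    _ = ε := by ring

/-! ### Resolvents of normal and unitary operators -/

section Resolvent

variable {H : Type*} [NormedAddCommGroup H] [InnerProductSpace ℂ H]

theorem sub_apply_resolvent {T : H →L[ℂ] H} {z : ℂ} (hz : z ∈ resolventSet ℂ T) (x : H) :
    z • resolvent T z x - T (resolvent T z x) = x := by
  have := DFunLike.congr_fun (Ring.mul_inverse_cancel _ hz) x
  simpa [resolvent, Algebra.algebraMap_eq_smul_one] using this

theorem resolvent_sub_apply {T : H →L[ℂ] H} {z : ℂ} (hz : z ∈ resolventSet ℂ T) (x : H) :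
    resolvent T z (z • x - T x) = x := by
  have := DFunLike.congr_fun (Ring.inverse_mul_cancel _ hz) x
  simpa [resolvent, Algebra.algebraMap_eq_smul_one] using this

/-- With x = (z - T)⁻¹e one has Tx = zx - e, and ‖Tx‖ = ‖x‖ is expanded. For a unit vector e this
locates the zeros of m and the solutions of z m = 1 relative to the unit circle. -/
theorem norm_sq_resolvent_apply {T : H →L[ℂ] H} (hT : ∀ x, ‖T x‖ = ‖x‖) {z : ℂ}
    (hz : z ∈ resolventSet ℂ T) (e : H) :
    2 * (z * inner ℂ e (resolvent T z e)).re
      = ‖e‖ ^ 2 + (‖z‖ ^ 2 - 1) * ‖resolvent T z e‖ ^ 2 := by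
  set x := resolvent T z e
  have h1 : T x = z • x - e := by
    have := sub_apply_resolvent hz e
    rw [eq_sub_iff_add_eq, ← eq_sub_iff_add_eq', this]
  have h2 : ‖x‖ ^ 2 = ‖z • x - e‖ ^ 2 := by rw [← h1, hT]
  rw [@norm_sub_sq ℂ, norm_smul, mul_pow] at h2
  have h3 : RCLike.re (inner ℂ (z • x) e) = (z * inner ℂ e x).re := by
    rw [← inner_conj_symm, inner_smul_right, RCLike.conj_re]; rfl
  rw [h3] at h2
  linarith

variable [CompleteSpace H]

theorem isStarNormal_algebraMap_sub {T : H →L[ℂ] H} (hT : IsStarNormal T) (z : ℂ) :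
    IsStarNormal (algebraMap ℂ (H →L[ℂ] H) z - T) := by
  rw [isStarNormal_iff]
  have h1 : star (algebraMap ℂ (H →L[ℂ] H) z - T) = algebraMap ℂ (H →L[ℂ] H) (conj z) - star T := by
    rw [star_sub, ← algebraMap_star_comm]; rfl
  rw [h1]
  exact Commute.sub_left (Algebra.commutes (conj z) _)
    (Commute.sub_right (Algebra.commutes z _).symm hT.star_comm_self)

/-- For a normal operator the orthogonal complement of the range is the kernel, so a lower bound
yields dense range in addition to injectivity. -/
theorem mem_resolventSet_of_le_norm {T : H →L[ℂ] H} (hT : IsStarNormal T) {z : ℂ} {δ : ℝ}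
    (hδ : 0 < δ) (h : ∀ x, δ * ‖x‖ ≤ ‖z • x - T x‖) : z ∈ resolventSet ℂ T := by
  have hN := isStarNormal_algebraMap_sub hT z
  rw [spectrum.mem_resolventSet_iff, ContinuousLinearMap.isUnit_iff_bijective,
    ContinuousLinearMap.bijective_iff_dense_range_and_antilipschitz]
  have hK (x : H) : δ * ‖x‖ ≤ ‖(algebraMap ℂ (H →L[ℂ] H) z - T) x‖ := by
    simpa [Algebra.algebraMap_eq_smul_one] using h x
  refine ⟨?_, (Real.toNNReal δ)⁻¹, ?_⟩
  · rw [Submodule.topologicalClosure_eq_top_iff, ContinuousLinearMap.IsStarNormal.orthogonal_range hN,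
      Submodule.eq_bot_iff]
    intro x hx
    have h1 := hK x
    rw [show (algebraMap ℂ (H →L[ℂ] H) z - T) x = 0 from hx, norm_zero] at h1
    exact norm_le_zero_iff.1 (by nlinarith [norm_nonneg x])
  · refine ContinuousLinearMap.antilipschitz_of_bound _ fun x => ?_
    rw [NNReal.coe_inv, Real.coe_toNNReal _ hδ.le, inv_mul_eq_div, le_div_iff₀ hδ, mul_comm]
    exact hK x

/-- The resolvent is normal, so its norm is its spectral radius, and its spectrum consists of the
inverses of the numbers z - w with w in the spectrum. -/
theorem norm_resolvent_le {T : H →L[ℂ] H} (hT : IsStarNormal T) {z : ℂ} {δ : ℝ} (hδ : 0 < δ)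
    (h : ∀ w ∈ spectrum ℂ T, δ ≤ ‖z - w‖) : ‖resolvent T z‖ ≤ δ⁻¹ := by
  have hz : z ∈ resolventSet ℂ T := by
    by_contra hz
    have := h z hz
    simp at this; linarith
  have hN := isStarNormal_algebraMap_sub hT z
  obtain ⟨u, hu⟩ : IsUnit (algebraMap ℂ (H →L[ℂ] H) z - T) := hz
  have hres : resolvent T z = ↑u⁻¹ := by rw [resolvent, ← hu, Ring.inverse_unit]
  rw [← hu] at hN
  have hNu : IsStarNormal (↑u⁻¹ : H →L[ℂ] H) := IsStarNormal.val_inv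
  have hrad := IsStarNormal.spectralRadius_eq_nnnorm (↑u⁻¹ : H →L[ℂ] H)
  have hle : spectralRadius ℂ (↑u⁻¹ : H →L[ℂ] H) ≤ ENNReal.ofReal δ⁻¹ := by
    refine iSup₂_le fun k hk => ?_
    rw [← spectrum.map_inv, Set.mem_inv, hu] at hk
    have : z - k⁻¹ ∈ spectrum ℂ T := by
      intro hmem
      apply hk
      rw [spectrum.mem_resolventSet_iff] at hmem ⊢
      rw [← neg_sub, IsUnit.neg_iff]
      convert hmem using 1
      rw [map_sub]; abel
    have h2 := h _ this
    rw [sub_sub_cancel, norm_inv] at h2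
    have hk0 : 0 < ‖k‖ := by
      by_contra h0
      have : ‖k‖ = 0 := le_antisymm (not_lt.1 h0) (norm_nonneg _)
      rw [this, inv_zero] at h2; linarith
    rw [← enorm_eq_nnnorm, ← ofReal_norm]
    exact ENNReal.ofReal_le_ofReal ((le_inv_comm₀ hδ hk0).1 h2)
  rw [hrad, ← enorm_eq_nnnorm, ← ofReal_norm, ENNReal.ofReal_le_ofReal_iff (by positivity)] at hle
  rwa [hres]

/-- Since TT* = 1, the resolvent at 1/z̄ is -z̄ T*R*, where R is the resolvent at z; moreover RTe =
zRe - e. -/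
theorem conj_inner_resolvent_inv {T : H →L[ℂ] H} (hT : T ∈ unitary (H →L[ℂ] H)) {z : ℂ}
    (hz : z ∈ resolventSet ℂ T) (hz0 : z ≠ 0) (e : H) (he : ‖e‖ = 1) :
    conj (inner ℂ e (resolvent T (conj z)⁻¹ e)) = z * (1 - z * inner ℂ e (resolvent T z e)) := by
  have hTN := isStarNormal_of_mem_unitary hT
  have hz' : (conj z)⁻¹ ∈ resolventSet ℂ T := by
    by_contra hc
    have h1 : ‖(conj z)⁻¹‖ = 1 := spectrum.norm_eq_one_of_unitary hT hc
    have h2 : (conj z)⁻¹ = z := by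
      rw [norm_inv, RCLike.norm_conj, inv_eq_one] at h1
      rw [inv_eq_iff_eq_inv, Complex.inv_def, Complex.normSq_eq_norm_sq, h1]
      simp
    rw [h2] at hc
    exact hc hz
  set R := resolvent T z
  have hRstar : conj z • star R e - star T (star R e) = e := by
    have h1 := DFunLike.congr_fun
      (congrArg star (show R * (algebraMap ℂ (H →L[ℂ] H) z - T) = 1 from
        Ring.inverse_mul_cancel _ hz)) e
    rw [star_mul, star_sub, ← algebraMap_star_comm] at h1
    simpa [Algebra.algebraMap_eq_smul_one] using h1
  have hTT (x : H) : T (star T x) = x := DFunLike.congr_fun (Unitary.mul_star_self_of_mem hT) x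
  have hy : (conj z)⁻¹ • (-conj z • star T (star R e)) - T (-conj z • star T (star R e)) = e := by
    have hc : conj z ≠ 0 := by simpa using hz0
    rw [map_smul, hTT, smul_smul, mul_neg, inv_mul_cancel₀ hc]
    conv_rhs => rw [← hRstar]
    module
  have h2 := resolvent_sub_apply hz' (-conj z • star T (star R e))
  rw [hy] at h2
  have h3 : R (T e) = z • R e - e := by
    have := resolvent_sub_apply hz e
    rw [map_sub, map_smul] at this
    rw [eq_sub_iff_add_eq, ← eq_sub_iff_add_eq', this]
  have h4 : inner ℂ e (star T (star R e)) = inner ℂ (R (T e)) e := by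
    rw [ContinuousLinearMap.star_eq_adjoint, ContinuousLinearMap.star_eq_adjoint,
      ContinuousLinearMap.adjoint_inner_right, ContinuousLinearMap.adjoint_inner_right]
  rw [h2, inner_smul_right, h4, map_mul, inner_conj_symm, h3, inner_sub_right, inner_smul_right,
    inner_self_eq_norm_sq_to_K, he]
  simp
  ring

/-- A uniform gap between z and the spectra bounds the resolvents uniformly near z, and then strong
convergence of the operators gives convergence of the resolvents, jointly in the index and the
spectral parameter. -/
theorem tendsto_inner_resolvent {ι : Type*} {l : Filter ι} {T : ι → H →L[ℂ] H} {T' : H →L[ℂ] H}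
    (hT : ∀ i, IsStarNormal (T i)) (hT' : IsStarNormal T')
    (hlim : ∀ x, Tendsto (fun i => T i x) l (𝓝 (T' x))) [l.NeBot] {z : ℂ} {δ : ℝ} (hδ : 0 < δ)
    (h : ∀ᶠ i in l, ∀ w ∈ spectrum ℂ (T i), δ ≤ ‖z - w‖) (e : H) :
    z ∈ resolventSet ℂ T' ∧ Tendsto (fun q : ι × ℂ => inner ℂ e (resolvent (T q.1) q.2 e))
      (l ×ˢ 𝓝 z) (𝓝 (inner ℂ e (resolvent T' z e))) := by
  have hres : ∀ᶠ i in l, ∀ w, ‖w - z‖ < δ / 2 →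
      w ∈ resolventSet ℂ (T i) ∧ ‖resolvent (T i) w‖ ≤ (δ / 2)⁻¹ := by
    filter_upwards [h] with i hi w hw
    have h1 : ∀ v ∈ spectrum ℂ (T i), δ / 2 ≤ ‖w - v‖ := fun v hv => by
      have h2 := hi v hv
      have h3 := norm_sub_le_norm_sub_add_norm_sub z w v
      rw [norm_sub_rev z w] at h3
      linarith
    refine ⟨?_, norm_resolvent_le (hT i) (by positivity) h1⟩
    by_contra hc
    have := h1 w hc
    simp at this; linarith
  -- The lower bound for z - T i survives the strong limit, and T' is normal.
  have hz : z ∈ resolventSet ℂ T' := by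
    refine mem_resolventSet_of_le_norm hT' (half_pos hδ) fun x => ?_
    have h1 : Tendsto (fun i => ‖z • x - T i x‖) l (𝓝 ‖z • x - T' x‖) :=
      ((hlim x).const_sub _).norm
    refine ge_of_tendsto h1 ?_
    filter_upwards [hres] with i hi
    obtain ⟨h2, h3⟩ := hi z (by simpa using half_pos hδ)
    have h4 := (resolvent (T i) z).le_opNorm (z • x - T i x)
    rw [resolvent_sub_apply h2] at h4
    have h5 := h4.trans (mul_le_mul_of_nonneg_right h3 (norm_nonneg _))
    rwa [inv_mul_eq_div, le_div_iff₀ (half_pos hδ), mul_comm] at h5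
  refine ⟨hz, ?_⟩
  set x := resolvent T' z e
  have hx : z • x - T' x = e := sub_apply_resolvent hz e
  have hvec : Tendsto (fun q : ι × ℂ => resolvent (T q.1) q.2 e) (l ×ˢ 𝓝 z) (𝓝 x) := by
    rw [tendsto_iff_norm_sub_tendsto_zero]
    have hb : Tendsto (fun q : ι × ℂ => (δ / 2)⁻¹ * ‖(z - q.2) • x + (T q.1 x - T' x)‖)
        (l ×ˢ 𝓝 z) (𝓝 0) := by
      have h1 : Tendsto (fun q : ι × ℂ => (z - q.2) • x) (l ×ˢ 𝓝 z) (𝓝 ((z - z) • x)) :=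
        (tendsto_snd.const_sub z).smul_const x
      have h2 : Tendsto (fun q : ι × ℂ => T q.1 x - T' x) (l ×ˢ 𝓝 z) (𝓝 (T' x - T' x)) :=
        ((hlim x).comp tendsto_fst).sub_const _
      simpa using (h1.add h2).norm.const_mul (δ / 2)⁻¹
    refine squeeze_zero' (Eventually.of_forall fun _ => norm_nonneg _) ?_ hb
    have hball : ∀ᶠ w in 𝓝 z, ‖w - z‖ < δ / 2 := by
      simp only [← dist_eq_norm]
      exact Metric.ball_mem_nhds z (half_pos hδ)
    filter_upwards [hres.prod_mk hball] with q hq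
    obtain ⟨h2, h3⟩ := hq.1 q.2 hq.2
    -- Resolvent identity: the difference of the operators acts only on the fixed vector x, so
    -- strong convergence is enough.
    have h4 : resolvent (T q.1) q.2 e - x
        = resolvent (T q.1) q.2 ((z - q.2) • x + (T q.1 x - T' x)) := by
      have : (z - q.2) • x + (T q.1 x - T' x) = e - (q.2 • x - T q.1 x) := by
        rw [← hx, sub_smul]; abel
      rw [this, map_sub, resolvent_sub_apply h2]
    rw [h4]
    exact (ContinuousLinearMap.le_opNorm _ _).trans
      (mul_le_mul_of_nonneg_right h3 (norm_nonneg _))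
  exact tendsto_const_nhds.inner hvec

end Resolvent

/-! ### The Szegő recursion -/

/-- The block diagonal matrices of the factorization `𝒞 = 𝓛ℳ`: the blocks occupy the indices
`(n, n + 1)` with `n ≡ s mod 2`. -/
noncomputable def pairMatrix (A R : ℕ → ℂ) (s : ℕ) : Matrix ℕ ℕ ℂ := fun i k =>
  if i % 2 = s then
    if k = i then conj (A (i + 1)) else if k = i + 1 then R (i + 1) else 0
  else if k + 1 = i then R i else if k = i then -A i else 0

/-- The top-left `n × n` block of `pairMatrix`. -/
noncomputable def pairCutoff (A R : ℕ → ℂ) (s n : ℕ) : Matrix (Fin n) (Fin n) ℂ :=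
  (pairMatrix A R s).submatrix (fun i => (i : ℕ)) (fun i => (i : ℕ))

theorem sum_pairMatrix_mul {A R : ℕ → ℂ} (h : RotationData A R) (s n i : ℕ) (hi : i < n)
    (f : ℕ → ℂ) : ∑ k ∈ Finset.range n, pairMatrix A R s i k * f k =
      if i % 2 = s then conj (A (i + 1)) * f i + (if i + 1 < n then R (i + 1) * f (i + 1) else 0)
      else R i * f (i - 1) - A i * f i := by
  split_ifs with h1 h2
  · have : ∀ k ∈ Finset.range n, pairMatrix A R s i k * f k
        = (if k = i then conj (A (i + 1)) * f i else 0)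
          + (if k = i + 1 then R (i + 1) * f (i + 1) else 0) := by
      intro k _
      rw [pairMatrix, if_pos h1]
      grind
    rw [Finset.sum_congr rfl this, Finset.sum_add_distrib, Finset.sum_ite_eq', Finset.sum_ite_eq',
      if_pos (Finset.mem_range.2 hi), if_pos (Finset.mem_range.2 h2)]
  · have : ∀ k ∈ Finset.range n, pairMatrix A R s i k * f k
        = (if k = i then conj (A (i + 1)) * f i else 0) := by
      intro k hk
      have := Finset.mem_range.1 hk
      rw [pairMatrix, if_pos h1]
      grind
    rw [Finset.sum_congr rfl this, Finset.sum_ite_eq', if_pos (Finset.mem_range.2 hi), add_zero]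
  · rcases i with _ | i
    · have : ∀ k ∈ Finset.range n, pairMatrix A R s 0 k * f k
          = (if k = 0 then - A 0 * f 0 else 0) := by
        intro k _
        rw [pairMatrix, if_neg h1]
        grind
      rw [Finset.sum_congr rfl this, Finset.sum_ite_eq', if_pos (Finset.mem_range.2 hi), h.R_zero]
      ring
    · have : ∀ k ∈ Finset.range n, pairMatrix A R s (i + 1) k * f k
          = (if k = i then R (i + 1) * f i else 0)
            + (if k = i + 1 then -A (i + 1) * f (i + 1) else 0) := by
        intro k _
        rw [pairMatrix, if_neg h1]
        grind
      rw [Finset.sum_congr rfl this, Finset.sum_add_distrib, Finset.sum_ite_eq',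
        Finset.sum_ite_eq', if_pos (Finset.mem_range.2 (by omega)), if_pos (Finset.mem_range.2 hi)]
      simp only [Nat.add_sub_cancel]
      ring

/-- A cut at n splits a block of at most one of the two factors, so truncation commutes with the
product although it is not multiplicative in general. -/
theorem cmvCutoff_eq_mul {α : ℕ → ℂ} (h : ∀ n, ‖α n‖ ≤ 1) (n : ℕ) :
    cmvCutoff α n = pairCutoff (cmvA α) (cmvR α) 0 n * pairCutoff (cmvA α) (cmvR α) 1 n := by
  have hd := rotationData_cmv h
  ext ⟨i, hi⟩ ⟨j, hj⟩
  have h1 : (pairCutoff (cmvA α) (cmvR α) 0 n * pairCutoff (cmvA α) (cmvR α) 1 n) ⟨i, hi⟩ ⟨j, hj⟩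
      = ∑ k ∈ Finset.range n, pairMatrix (cmvA α) (cmvR α) 0 i k
          * pairMatrix (cmvA α) (cmvR α) 1 k j := by
    rw [Matrix.mul_apply, Finset.sum_range]
    rfl
  rw [h1, sum_pairMatrix_mul hd 0 n i hi]
  change cmvMatrix α i j = _
  have hR := hd.R_zero
  rcases Nat.even_or_odd' i with ⟨k, rfl | rfl⟩
  · rw [cmvMatrix_even]
    unfold pairMatrix
    grind
  · rw [cmvMatrix_odd]
    unfold pairMatrix
    grind

/-- For n ≡ s mod 2 the cut falls between two blocks. The truncated matrix is then unitary and
symmetric, so its inverse is its entrywise conjugate. -/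
theorem conj_pairCutoff_mul_self {A R : ℕ → ℂ} (h : RotationData A R) {s n : ℕ}
    (hn : n % 2 = s) :
    (pairCutoff A R s n).map (starRingEnd ℂ) * pairCutoff A R s n = 1 := by
  have hc (i k : ℕ) : conj (pairMatrix A R s i k) = pairMatrix (fun n => conj (A n)) R s i k := by
    unfold pairMatrix
    split_ifs <;> simp [h.conj_R]
  have hd' : RotationData (fun n => conj (A n)) R :=
    ⟨h.conj_R, fun n => by rw [Complex.conj_conj, mul_comm (conj _)]; exact h.sq_add n,
      by simp [h.A_zero], h.R_zero⟩
  ext ⟨i, hi⟩ ⟨j, hj⟩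
  have h1 : ((pairCutoff A R s n).map (starRingEnd ℂ) * pairCutoff A R s n) ⟨i, hi⟩ ⟨j, hj⟩
      = ∑ k ∈ Finset.range n, pairMatrix (fun n => conj (A n)) R s i k * pairMatrix A R s k j := by
    rw [Matrix.mul_apply, Finset.sum_range]
    simp only [← hc]
    rfl
  rw [h1, sum_pairMatrix_mul hd' s n i hi, Matrix.one_apply]
  simp only [Fin.mk.injEq]
  have e1 := h.sq_add i
  have e2 := h.sq_add (i + 1)
  have e3 := h.R_zero
  have e4 := h.A_zero
  unfold pairMatrix
  rw [Complex.conj_conj]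
  by_cases hi2 : i % 2 = s
  · grind
  · rcases i with _ | i
    · grind
    · rw [Nat.add_sub_cancel]
      grind

/-- Index n opens a new block, of which only the upper left corner survives the cut. -/
theorem pairCutoff_succ (A R : ℕ → ℂ) {s n : ℕ} (hn : n % 2 = s) :
    pairCutoff A R s (n + 1) = (Matrix.fromBlocks (pairCutoff A R s n) 0 0
      (Matrix.of fun _ _ => conj (A (n + 1)))).submatrix finSumFinEquiv.symm finSumFinEquiv.symm := by
  rw [← Matrix.reindex_apply, ← Equiv.symm_apply_eq, Matrix.reindex_symm, Matrix.reindex_apply]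
  ext (i | i) (j | j)
  · rfl
  · have := i.2
    simp only [pairCutoff, pairMatrix, Matrix.submatrix_apply]
    simp
    grind
  · have := j.2
    simp only [pairCutoff, pairMatrix, Matrix.submatrix_apply]
    simp
    grind
  · simp only [pairCutoff, pairMatrix, Matrix.submatrix_apply]
    simp [hn]

theorem det_pairCutoff_add_two {A R : ℕ → ℂ} (h : RotationData A R) {s n : ℕ}
    (hn : n % 2 = s) :
    (pairCutoff A R s (n + 2)).det = -(pairCutoff A R s n).det := by
  have h1 : pairCutoff A R s (n + 2) = (Matrix.fromBlocks (pairCutoff A R s n) 0 0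
      !![conj (A (n + 1)), R (n + 1); R (n + 1), -A (n + 1)]).submatrix
        finSumFinEquiv.symm finSumFinEquiv.symm := by
    rw [← Matrix.reindex_apply, ← Equiv.symm_apply_eq, Matrix.reindex_symm, Matrix.reindex_apply]
    ext (i | i) (j | j)
    · rfl
    · have := i.2
      simp only [pairCutoff, pairMatrix, Matrix.submatrix_apply]
      simp
      grind
    · have := j.2
      simp only [pairCutoff, pairMatrix, Matrix.submatrix_apply]
      simp
      grind
    · fin_cases i <;> fin_cases j <;> simp [pairCutoff, pairMatrix] <;> grind
  rw [h1, Matrix.det_submatrix_equiv_self, Matrix.det_fromBlocks_zero₂₁, Matrix.det_fin_two_of]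
  have := h.sq_add (n + 1)
  linear_combination -(pairCutoff A R s n).det * this

/-- Every complete block has determinant -1, and the single index 0 contributes -A 0 = 1. This is
the normalization that leaves no extra factor in the Szegő recursion. -/
theorem neg_one_pow_mul_det_pairCutoff {A R : ℕ → ℂ} (h : RotationData A R) (n : ℕ) :
    (-1) ^ n * (pairCutoff A R (n % 2) n).det * (pairCutoff A R ((n + 1) % 2) (n + 1)).det = 1 := by
  induction n with
  | zero => simp [pairCutoff, pairMatrix, h.A_zero]
  | succ n ih =>
    rw [show (n + 1 + 1) % 2 = n % 2 by omega,
      det_pairCutoff_add_two h rfl]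
    rw [pow_succ]
    linear_combination ih

/-- The Szegő recursion in matrix form. The last row is z times a unit vector minus w times the last
row of B, and the determinant is linear in it. The first term gives the smaller characteristic
determinant; in the second one B = (B')⁻¹ can be factored out on the right, which leaves the
reversed determinant. -/
theorem det_smul_one_sub_fromBlocks_mul {m : Type*} [Fintype m] [DecidableEq m]
    (z w : ℂ) (P P' : Matrix m m ℂ) (hP : P' * P = 1)
    (B B' : Matrix (m ⊕ Fin 1) (m ⊕ Fin 1) ℂ) (hB : B' * B = 1) :
    (z • 1 - Matrix.fromBlocks P 0 0 (Matrix.of fun _ _ => w) * B).det =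
      z * (z • 1 - P * B.toBlocks₁₁).det
        - w * ((-1) ^ Fintype.card m * P.det * B.det * (1 - z • (B'.toBlocks₁₁ * P')).det) := by
  set N := z • 1 - Matrix.fromBlocks P 0 0 (Matrix.of fun _ _ => w) * B with hN
  have hrow : N = N.updateRow (Sum.inr 0)
      (z • (1 : Matrix (m ⊕ Fin 1) (m ⊕ Fin 1) ℂ) (Sum.inr 0) + (-w) • B (Sum.inr 0)) := by
    ext i j
    rcases i with i | i
    · simp [Matrix.updateRow_apply]
    · obtain rfl : i = 0 := Subsingleton.elim _ _
      rw [Matrix.updateRow_self, hN]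
      simp [Matrix.mul_apply, Fintype.sum_sum_type]
      ring
  have e1 : (N.updateRow (Sum.inr 0) ((1 : Matrix (m ⊕ Fin 1) (m ⊕ Fin 1) ℂ) (Sum.inr 0)))
      = Matrix.fromBlocks (z • 1 - P * B.toBlocks₁₁) (- (P * B.toBlocks₁₂)) 0 1 := by
    ext i j
    rcases i with i | i
    · rw [Matrix.updateRow_ne (by simp)]
      rcases j with j | j <;>
      simp [hN, Matrix.mul_apply, Fintype.sum_sum_type, Matrix.one_apply, Matrix.toBlocks₁₁,
        Matrix.toBlocks₁₂]
    · obtain rfl : i = 0 := Subsingleton.elim _ _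
      rw [Matrix.updateRow_self]
      rcases j with j | j <;> simp [Matrix.one_apply]
  have e2 : N.updateRow (Sum.inr 0) (B (Sum.inr 0))
      = Matrix.fromBlocks (z • B'.toBlocks₁₁ - P) (z • B'.toBlocks₁₂) 0 1 * B := by
    have hz : z • (1 : Matrix (m ⊕ Fin 1) (m ⊕ Fin 1) ℂ) = (z • B') * B := by
      rw [smul_mul_assoc, hB]
    ext i j
    rcases i with i | i
    · rw [Matrix.updateRow_ne (by simp), hN, hz]
      simp [Matrix.mul_apply, Fintype.sum_sum_type, Matrix.toBlocks₁₁, Matrix.toBlocks₁₂,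
        Finset.sum_sub_distrib, sub_mul]
      rw [mul_add, Finset.mul_sum]
      simp only [mul_assoc]
      ring
    · obtain rfl : i = 0 := Subsingleton.elim _ _
      rw [Matrix.updateRow_self]
      simp [Matrix.mul_apply, Fintype.sum_sum_type]
  have e3 : z • B'.toBlocks₁₁ - P = -((1 - z • (B'.toBlocks₁₁ * P')) * P) := by
    rw [sub_mul, smul_mul_assoc, mul_assoc, hP, mul_one, one_mul, neg_sub]
  rw [hrow, Matrix.det_updateRow_add, Matrix.det_updateRow_smul, Matrix.det_updateRow_smul, e1, e2,
    Matrix.det_fromBlocks_zero₂₁, Matrix.det_mul, Matrix.det_fromBlocks_zero₂₁, e3, Matrix.det_neg,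
    Matrix.det_mul, Matrix.det_one]
  ring

theorem eval_charpolyRev_eq_det {m : Type*} [Fintype m] [DecidableEq m] (M : Matrix m m ℂ) (z : ℂ) :
    M.charpolyRev.eval z = (1 - z • M).det := by
  rw [Matrix.charpolyRev, ← Polynomial.coe_evalRingHom, RingHom.map_det]
  congr 1
  ext i j
  by_cases hij : i = j <;> simp [hij, mul_comm z]

/-- The characteristic polynomial does not depend on the order of the factors, so the order can be
adapted to the parity of n. -/
theorem opuc_eq_charpoly_mul {α : ℕ → ℂ} (h : ∀ n, ‖α n‖ ≤ 1) (n m : ℕ) :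
    opuc α n = (pairCutoff (cmvA α) (cmvR α) (m % 2) n
      * pairCutoff (cmvA α) (cmvR α) ((m + 1) % 2) n).charpoly := by
  rw [opuc, cmvCutoff_eq_mul h]
  rcases Nat.mod_two_eq_zero_or_one m with hm | hm
  · rw [hm, show (m + 1) % 2 = 1 by omega]
  · rw [hm, show (m + 1) % 2 = 0 by omega, Matrix.charpoly_mul_comm]

theorem natDegree_opuc (α : ℕ → ℂ) (n : ℕ) : (opuc α n).natDegree = n := by
  rw [opuc, Matrix.charpoly_natDegree_eq_dim, Fintype.card_fin]

theorem opucStar_eq_charpolyRev {α : ℕ → ℂ} (h : ∀ n, ‖α n‖ ≤ 1) (n m : ℕ) :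
    opucStar α n = ((pairCutoff (cmvA α) (cmvR α) (m % 2) n
      * pairCutoff (cmvA α) (cmvR α) ((m + 1) % 2) n).map (starRingEnd ℂ)).charpolyRev := by
  rw [← Matrix.reverse_charpoly, Matrix.charpoly_map, ← opuc_eq_charpoly_mul h, opucStar,
    Polynomial.reverse, Polynomial.natDegree_map, natDegree_opuc]

/-- The Szegő recursion. -/
theorem opuc_succ {α : ℕ → ℂ} (h : ∀ n, ‖α n‖ ≤ 1) (n : ℕ) :
    opuc α (n + 1) = X * opuc α n - C (conj (α n)) * opucStar α n := by
  have hd := rotationData_cmv h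
  refine Polynomial.funext fun z => ?_
  have hc := conj_pairCutoff_mul_self hd (s := n % 2) (n := n) rfl
  have hc' := conj_pairCutoff_mul_self hd (s := (n + 1) % 2) (n := n + 1) rfl
  have hdet := neg_one_pow_mul_det_pairCutoff hd n
  simp only [eval_sub, eval_mul, eval_X, eval_C]
  rw [opuc_eq_charpoly_mul h (n + 1) n, opuc_eq_charpoly_mul h n n,
    opucStar_eq_charpolyRev h n (n + 1), show (n + 1 + 1) % 2 = n % 2 by omega,
    eval_charpolyRev_eq_det, Matrix.eval_charpoly, Matrix.eval_charpoly, pairCutoff_succ _ _ rfl]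
  set P := pairCutoff (cmvA α) (cmvR α) (n % 2) n
  set Q := pairCutoff (cmvA α) (cmvR α) ((n + 1) % 2) n
  set B := pairCutoff (cmvA α) (cmvR α) ((n + 1) % 2) (n + 1) with hB
  let e : Fin n ⊕ Fin 1 ≃ Fin (n + 1) := finSumFinEquiv
  have hBB : B = (B.submatrix e e).submatrix e.symm e.symm := by simp
  have hB11 : (B.submatrix e e).toBlocks₁₁ = Q := rfl
  have hB11' : ((B.submatrix e e).map (starRingEnd ℂ)).toBlocks₁₁ = Q.map (starRingEnd ℂ) := rfl
  have hBc : (B.submatrix e e).map (starRingEnd ℂ) * B.submatrix e e = 1 := by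
    have : (B.submatrix e e).map (starRingEnd ℂ) = (B.map (starRingEnd ℂ)).submatrix e e := rfl
    rw [this, Matrix.submatrix_mul_equiv, hc', Matrix.submatrix_one_equiv]
  -- In passing from n to n + 1 only the factor P acquires the new coefficient; B, of size n + 1, is
  -- still unitary and has Q as its upper left block.
  have key := det_smul_one_sub_fromBlocks_mul z (conj (α n)) P (P.map (starRingEnd ℂ)) hc
    (B.submatrix e e) _ hBc
  rw [hB11, hB11', Matrix.det_submatrix_equiv_self, Fintype.card_fin, hdet, one_mul] at key
  have hz (m : ℕ) : Matrix.scalar (Fin m) z = z • 1 := by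
    rw [Matrix.scalar_apply, Matrix.smul_one_eq_diagonal]
  rw [Matrix.map_mul, hz, hz, ← key, hBB, Matrix.submatrix_mul_equiv]
  rw [← Matrix.det_submatrix_equiv_self e]
  congr 1
  ext i j
  simp [Matrix.one_apply, e, cmvA]

/-- Conjugation followed by reflection in degree n + 1 exchanges XΦ_n and Φ_n^*, and so turns one
recursion into the other. -/
theorem opucStar_succ {α : ℕ → ℂ} (h : ∀ n, ‖α n‖ ≤ 1) (n : ℕ) :
    opucStar α (n + 1) = opucStar α n - C (α n) * (X * opuc α n) := by
  have h1 : ((X : ℂ[X]) * (opuc α n).map (starRingEnd ℂ)).reflect (n + 1) = opucStar α n := by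
    rw [add_comm n 1, reflect_mul _ _ natDegree_X_le
      (by rw [natDegree_map, natDegree_opuc]), reflect_one_X, one_mul, opucStar]
  have h2 : ((opucStar α n).map (starRingEnd ℂ)).reflect (n + 1) = X * opuc α n := by
    have h3 : (opucStar α n).map (starRingEnd ℂ) = (opuc α n).reflect n := by
      rw [opucStar, ← reflect_map, Polynomial.map_map]
      have : (starRingEnd ℂ).comp (starRingEnd ℂ) = RingHom.id ℂ := by ext x; simp
      rw [this, Polynomial.map_id]
    rw [h3]
    have h4 : (opuc α n).natDegree ≤ n := (natDegree_opuc α n).le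
    have h5 : (((1 : ℂ[X]) * (opuc α n).reflect n)).reflect (1 + n)
        = (1 : ℂ[X]).reflect 1 * ((opuc α n).reflect n).reflect n :=
      reflect_mul _ _ (by simp) (natDegree_reflect_le.trans (by simp [h4]))
    rw [one_mul, reflect_reflect, reflect_one, pow_one, add_comm] at h5
    exact h5
  rw [opucStar, opuc_succ h, Polynomial.map_sub, Polynomial.map_mul, Polynomial.map_mul, map_X,
    map_C, Complex.conj_conj, reflect_sub, h1, reflect_C_mul, h2]

theorem opuc_congr {α α' : ℕ → ℂ} {n : ℕ} (h : ∀ i < n, α i = α' i) : opuc α n = opuc α' n := by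
  have hA : ∀ m ≤ n, cmvA α m = cmvA α' m := by
    rintro (_ | m) hm
    · rfl
    · exact h m hm
  have hR : ∀ m ≤ n, cmvR α m = cmvR α' m := fun m hm => by rw [cmvR, cmvR, hA m hm]
  rw [opuc, opuc]
  congr 1
  ext ⟨i, hi⟩ ⟨j, hj⟩
  change cmvMatrix α i j = cmvMatrix α' i j
  rcases Nat.even_or_odd' i with ⟨k, rfl | rfl⟩
  · rw [cmvMatrix_even, cmvMatrix_even]
    grind
  · rw [cmvMatrix_odd, cmvMatrix_odd]
    grind

theorem norm_update_le {α : ℕ → ℂ} (h : ∀ n, ‖α n‖ ≤ 1) {β : ℂ} (hβ : ‖β‖ = 1) (m n : ℕ) :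
    ‖Function.update α m β n‖ ≤ 1 := by
  by_cases hn : n = m
  · rw [hn, Function.update_self, hβ]
  · rw [Function.update_of_ne hn]
    exact h n

theorem popuc_succ {α : ℕ → ℂ} (h : ∀ n, ‖α n‖ ≤ 1) {β : ℂ} (hβ : ‖β‖ = 1) (n : ℕ) :
    popuc β α (n + 1) = X * opuc α n - C (conj β) * opucStar α n := by
  have h1 : opuc (Function.update α n β) n = opuc α n :=
    opuc_congr fun i hi => Function.update_of_ne hi.ne _ _
  have h2 := opuc_succ (norm_update_le h hβ n) n
  rwa [opucStar, h1, Function.update_self] at h2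

/-! ### Reversal of a finite CMV matrix -/

/-- The coefficients of the reversed finite CMV matrix: `-ᾱ_{n-1} β, …, -ᾱ_0 β, β`, continued by
coefficients of modulus one for which all further basis vectors are eigenvectors with
eigenvalue `ω`. -/
noncomputable def revSeq (α : ℕ → ℂ) (β ω : ℂ) (n l : ℕ) : ℂ :=
  if l < n then -conj (α (n - 1 - l)) * β else (-conj ω) ^ (l - n) * β

theorem norm_revSeq_le {α : ℕ → ℂ} (h : ∀ n, ‖α n‖ ≤ 1) {β ω : ℂ} (hβ : ‖β‖ = 1) (hω : ‖ω‖ = 1)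
    (n l : ℕ) : ‖revSeq α β ω n l‖ ≤ 1 := by
  unfold revSeq
  split_ifs
  · simpa [hβ] using h _
  · simp [hβ, hω]

theorem norm_revSeq_of_le (α : ℕ → ℂ) {β ω : ℂ} (hβ : ‖β‖ = 1) (hω : ‖ω‖ = 1)
    {n l : ℕ} (hl : n ≤ l) : ‖revSeq α β ω n l‖ = 1 := by
  rw [revSeq, if_neg (by omega)]
  simp [hβ, hω]

theorem conj_mul_self_of_norm_eq_one {β : ℂ} (hβ : ‖β‖ = 1) : conj β * β = 1 := by
  rw [mul_comm, Complex.mul_conj, Complex.normSq_eq_norm_sq, hβ]; simp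

/-- The map c ↦ -c̄β exchanges the boundary values α_{-1} = -1 and β, so the rule for reversed
coefficients also holds at both ends. -/
theorem cmvA_revSeq (α : ℕ → ℂ) {β : ℂ} (hβ : ‖β‖ = 1) (ω : ℂ) {n m m' : ℕ} (hm : m + m' = n + 1) :
    cmvA (revSeq α β ω n) m = -conj (cmvA (Function.update α n β) m') * β := by
  rcases m with _ | m
  · obtain rfl : m' = n + 1 := by omega
    simp [cmvA, conj_mul_self_of_norm_eq_one hβ]
  · rcases m' with _ | m'
    · obtain rfl : m = n := by omega
      simp [cmvA, revSeq]
    · have h1 : n - 1 - m = m' := by omega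
      simp only [cmvA, revSeq]
      rw [if_pos (by omega), Function.update_of_ne (by omega), h1]

theorem cmvR_revSeq (α : ℕ → ℂ) {β : ℂ} (hβ : ‖β‖ = 1) (ω : ℂ) {n m m' : ℕ} (hm : m + m' = n + 1) :
    cmvR (revSeq α β ω n) m = cmvR (Function.update α n β) m' := by
  rw [cmvR, cmvA_revSeq α hβ ω hm, cmvR]
  simp [hβ]

/-- The diagonal entries of the conjugation between a reversed CMV matrix and the flip of the
original matrix. -/
noncomputable def revDiag (β : ℂ) (i : ℕ) : ℂ := if i % 2 = 0 then conj β else 1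

theorem revDiag_ne_zero {β : ℂ} (hβ : ‖β‖ = 1) (i : ℕ) : revDiag β i ≠ 0 := by
  have : β ≠ 0 := by rintro rfl; simp at hβ
  unfold revDiag
  split_ifs <;> simp [this]

/-- For odd n the flip i ↦ n - i maps pairs starting at an even index to pairs of the same kind, so
the order of 𝓛 and ℳ is preserved. The phases β left over are absorbed by the diagonal matrix. -/
theorem cmvMatrix_revSeq_odd (α : ℕ → ℂ) {β : ℂ} (hβ : ‖β‖ = 1) (ω : ℂ) {n i j i' j' : ℕ}
    (hn : n % 2 = 1) (hi : i + i' = n) (hj : j + j' = n) :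
    cmvMatrix (revSeq α β ω n) i j * revDiag β j
      = revDiag β i * cmvMatrix (Function.update α n β) i' j' := by
  have hβ' := conj_mul_self_of_norm_eq_one hβ
  rcases Nat.even_or_odd' i with ⟨k, rfl | rfl⟩
  · obtain ⟨k', rfl⟩ : ∃ k', i' = 2 * k' + 1 := ⟨i' / 2, by omega⟩
    rw [cmvMatrix_even, cmvMatrix_odd,
      cmvA_revSeq α hβ ω (show 2 * k + (2 * k' + 2) = n + 1 by omega),
      cmvA_revSeq α hβ ω (show 2 * k + 1 + (2 * k' + 1) = n + 1 by omega),
      cmvA_revSeq α hβ ω (show 2 * k + 2 + 2 * k' = n + 1 by omega),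
      cmvR_revSeq α hβ ω (show 2 * k + (2 * k' + 2) = n + 1 by omega),
      cmvR_revSeq α hβ ω (show 2 * k + 1 + (2 * k' + 1) = n + 1 by omega),
      cmvR_revSeq α hβ ω (show 2 * k + 2 + 2 * k' = n + 1 by omega)]
    simp only [map_mul, map_neg, Complex.conj_conj]
    unfold revDiag
    grind (splits := 30)
  · obtain ⟨k', rfl⟩ : ∃ k', i' = 2 * k' := ⟨i' / 2, by omega⟩
    rw [cmvMatrix_even, cmvMatrix_odd,
      cmvA_revSeq α hβ ω (show 2 * k + (2 * k' + 2) = n + 1 by omega),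
      cmvA_revSeq α hβ ω (show 2 * k + 1 + (2 * k' + 1) = n + 1 by omega),
      cmvA_revSeq α hβ ω (show 2 * k + 2 + 2 * k' = n + 1 by omega),
      cmvR_revSeq α hβ ω (show 2 * k + (2 * k' + 2) = n + 1 by omega),
      cmvR_revSeq α hβ ω (show 2 * k + 1 + (2 * k' + 1) = n + 1 by omega),
      cmvR_revSeq α hβ ω (show 2 * k + 2 + 2 * k' = n + 1 by omega)]
    simp only [map_mul, map_neg, Complex.conj_conj]
    unfold revDiag
    grind (splits := 30)

/-- For even n the flip exchanges the two kinds of pairs, hence 𝓛 and ℳ. As both factors are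
symmetric, this transposes the product, and i' and j' appear in swapped order. -/
theorem cmvMatrix_revSeq_even (α : ℕ → ℂ) {β : ℂ} (hβ : ‖β‖ = 1) (ω : ℂ) {n i j i' j' : ℕ}
    (hn : n % 2 = 0) (hi : i + i' = n) (hj : j + j' = n) :
    cmvMatrix (revSeq α β ω n) i j * revDiag β j
      = revDiag β i * cmvMatrix (Function.update α n β) j' i' := by
  have hβ' := conj_mul_self_of_norm_eq_one hβ
  rcases Nat.even_or_odd' i with ⟨k, rfl | rfl⟩
  · obtain ⟨k', rfl⟩ : ∃ k', i' = 2 * k' := ⟨i' / 2, by omega⟩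
    rcases k' with _ | k'
    · rw [cmvMatrix_even,
        cmvA_revSeq α hβ ω (show 2 * k + 1 = n + 1 by omega),
        cmvA_revSeq α hβ ω (show 2 * k + 1 + 0 = n + 1 by omega),
        cmvR_revSeq α hβ ω (show 2 * k + 1 = n + 1 by omega)]
      simp only [map_mul, map_neg, Complex.conj_conj]
      rcases Nat.even_or_odd' j' with ⟨l, rfl | rfl⟩
      · rw [cmvMatrix_even]
        unfold revDiag
        grind (splits := 30)
      · rw [cmvMatrix_odd]
        unfold revDiag
        grind (splits := 30)
    · rw [cmvMatrix_even,
        cmvA_revSeq α hβ ω (show 2 * k + (2 * k' + 3) = n + 1 by omega),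
        cmvA_revSeq α hβ ω (show 2 * k + 1 + (2 * k' + 2) = n + 1 by omega),
        cmvA_revSeq α hβ ω (show 2 * k + 2 + (2 * k' + 1) = n + 1 by omega),
        cmvR_revSeq α hβ ω (show 2 * k + (2 * k' + 3) = n + 1 by omega),
        cmvR_revSeq α hβ ω (show 2 * k + 1 + (2 * k' + 2) = n + 1 by omega),
        cmvR_revSeq α hβ ω (show 2 * k + 2 + (2 * k' + 1) = n + 1 by omega)]
      simp only [map_mul, map_neg, Complex.conj_conj]
      rcases Nat.even_or_odd' j' with ⟨l, rfl | rfl⟩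
      · rw [cmvMatrix_even]
        unfold revDiag
        grind (splits := 30)
      · rw [cmvMatrix_odd]
        unfold revDiag
        grind (splits := 30)
  · obtain ⟨k', rfl⟩ : ∃ k', i' = 2 * k' + 1 := ⟨i' / 2, by omega⟩
    rw [cmvMatrix_odd,
      cmvA_revSeq α hβ ω (show 2 * k + (2 * k' + 3) = n + 1 by omega),
      cmvA_revSeq α hβ ω (show 2 * k + 1 + (2 * k' + 2) = n + 1 by omega),
      cmvA_revSeq α hβ ω (show 2 * k + 2 + (2 * k' + 1) = n + 1 by omega),
      cmvR_revSeq α hβ ω (show 2 * k + (2 * k' + 3) = n + 1 by omega),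
      cmvR_revSeq α hβ ω (show 2 * k + 1 + (2 * k' + 2) = n + 1 by omega),
      cmvR_revSeq α hβ ω (show 2 * k + 2 + (2 * k' + 1) = n + 1 by omega)]
    simp only [map_mul, map_neg, Complex.conj_conj]
    rcases Nat.even_or_odd' j' with ⟨l, rfl | rfl⟩
    · rw [cmvMatrix_even]
      unfold revDiag
      grind (splits := 30)
    · rw [cmvMatrix_odd]
      unfold revDiag
      grind (splits := 30)

/-- The principal minors of a reversed finite CMV matrix agree with those of the flipped matrix. -/
theorem det_sub_cutoff_revSeq (α : ℕ → ℂ) {β : ℂ} (hβ : ‖β‖ = 1) (ω : ℂ) (n : ℕ) {m : ℕ}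
    (f : Fin m → Fin (n + 1)) (z : ℂ) :
    ((Matrix.scalar _ z - cmvCutoff (revSeq α β ω n) (n + 1)).submatrix f f).det
      = ((Matrix.scalar _ z - cmvCutoff (Function.update α n β) (n + 1)).submatrix
          (fun i => (f i).rev) (fun i => (f i).rev)).det := by
  set U := Matrix.scalar _ z - cmvCutoff (revSeq α β ω n) (n + 1)
  set V := Matrix.scalar _ z - cmvCutoff (Function.update α n β) (n + 1)
  have hrev (i : Fin (n + 1)) : (i : ℕ) + (i.rev : ℕ) = n := by
    rw [Fin.val_rev]; have := i.2; omega
  let D : Matrix (Fin m) (Fin m) ℂ := Matrix.diagonal fun i => revDiag β (f i)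
  have hD : D.det ≠ 0 := by
    rw [Matrix.det_diagonal]
    exact Finset.prod_ne_zero_iff.2 fun i _ => revDiag_ne_zero hβ _
  have hsc (i j : Fin (n + 1)) : Matrix.scalar (Fin (n + 1)) z i j
      = Matrix.scalar (Fin (n + 1)) z i.rev j.rev := by
    simp [Matrix.scalar_apply, Matrix.diagonal_apply]
  have hsc' (i j : Fin (n + 1)) : Matrix.scalar (Fin (n + 1)) z i j
      = Matrix.scalar (Fin (n + 1)) z j.rev i.rev := by
    simp [Matrix.scalar_apply, Matrix.diagonal_apply, eq_comm]
  have hswap (i j : Fin (n + 1)) : Matrix.scalar (Fin (n + 1)) z i j * revDiag β j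
      = revDiag β i * Matrix.scalar (Fin (n + 1)) z i j := by
    by_cases hij : i = j
    · rw [hij, mul_comm]
    · simp [Matrix.scalar_apply, Matrix.diagonal_apply_ne _ hij]
  have key : U.submatrix f f * D = D * V.submatrix (fun i => (f i).rev) (fun i => (f i).rev) ∨
      U.submatrix f f * D = D * (V.submatrix (fun i => (f i).rev) (fun i => (f i).rev)).transpose := by
    rcases Nat.mod_two_eq_zero_or_one n with hn | hn
    · right
      ext i j
      have := cmvMatrix_revSeq_even α hβ ω hn (hrev (f i)) (hrev (f j))
      rw [Matrix.mul_diagonal, Matrix.diagonal_mul]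
      simp only [Matrix.submatrix_apply, Matrix.transpose_apply, U, V, Matrix.sub_apply, sub_mul,
        mul_sub, hsc' (f i) (f j)]
      congr 1
      rw [← hsc' (f i) (f j)]
      exact hswap _ _
    · left
      ext i j
      have := cmvMatrix_revSeq_odd α hβ ω hn (hrev (f i)) (hrev (f j))
      rw [Matrix.mul_diagonal, Matrix.diagonal_mul]
      simp only [Matrix.submatrix_apply, U, V, Matrix.sub_apply, sub_mul,
        mul_sub, hsc (f i) (f j)]
      congr 1
      rw [← hsc (f i) (f j)]
      exact hswap _ _
  rcases key with key | key
  · have := congrArg Matrix.det key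
    rw [Matrix.det_mul, Matrix.det_mul, mul_comm] at this
    exact mul_left_cancel₀ hD this
  · have := congrArg Matrix.det key
    rw [Matrix.det_mul, Matrix.det_mul, mul_comm, Matrix.det_transpose] at this
    exact mul_left_cancel₀ hD this

theorem charpoly_cutoff_revSeq (α : ℕ → ℂ) {β : ℂ} (hβ : ‖β‖ = 1) (ω : ℂ) (n : ℕ) :
    (cmvCutoff (revSeq α β ω n) (n + 1)).charpoly = popuc β α (n + 1) := by
  refine Polynomial.funext fun z => ?_
  have := det_sub_cutoff_revSeq α hβ ω n id z
  rw [popuc, Nat.add_sub_cancel, Matrix.eval_charpoly, Matrix.eval_charpoly,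
    ← Matrix.det_submatrix_equiv_self Fin.revPerm (_ - cmvCutoff (Function.update α n β) (n + 1))]
  exact this

/-- Deleting the first index of the reversed matrix deletes the last index of the original one, and
with it the coefficient β. -/
theorem adjugate_cutoff_revSeq (α : ℕ → ℂ) {β : ℂ} (hβ : ‖β‖ = 1) (ω : ℂ) (n : ℕ) (z : ℂ) :
    (Matrix.scalar _ z - cmvCutoff (revSeq α β ω n) (n + 1)).adjugate 0 0
      = (opuc α n).eval z := by
  have h1 : opuc α n = opuc (Function.update α n β) n :=
    opuc_congr fun i hi => (Function.update_of_ne hi.ne _ _).symm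
  rw [Matrix.adjugate_fin_succ_eq_det_submatrix, h1, opuc, Matrix.eval_charpoly,
    ← Matrix.det_submatrix_equiv_self Fin.revPerm (_ - cmvCutoff (Function.update α n β) n)]
  have := det_sub_cutoff_revSeq α hβ ω n Fin.succ z
  simp only [Fin.val_zero, add_zero, pow_zero, one_mul, Fin.succAbove_zero]
  rw [this]
  congr 1
  ext i j
  simp [Fin.rev_succ, Matrix.scalar_apply, Matrix.diagonal_apply, cmvCutoff]

/-! ### Finite CMV matrices as blocks of CMV operators -/

/-- The inclusion of `ℂⁿ` into `ℓ²(ℕ₀)`. -/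
noncomputable def finInclusion (n : ℕ) : (Fin n → ℂ) →ₗ[ℂ] Ell2 :=
  ∑ j : Fin n, (LinearMap.proj j).smulRight (ell2Basis (j : ℕ))

theorem finInclusion_apply {n : ℕ} (v : Fin n → ℂ) (i : ℕ) :
    (finInclusion n v : Ell2) i = if h : i < n then v ⟨i, h⟩ else 0 := by
  have h1 : (finInclusion n v : Ell2) i = ∑ j : Fin n, v j * if i = (j : ℕ) then 1 else 0 := by
    simp only [finInclusion, LinearMap.sum_apply, LinearMap.smulRight_apply, LinearMap.proj_apply]
    rw [lp.coeFn_sum, Finset.sum_apply]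
    exact Finset.sum_congr rfl fun j _ => by
      rw [lp.coeFn_smul, Pi.smul_apply, ell2Basis_coord, smul_eq_mul]
  rw [h1]
  split_ifs with h
  · rw [Finset.sum_eq_single ⟨i, h⟩]
    · simp
    · intro b _ hb
      rw [if_neg, mul_zero]
      intro hib
      exact hb (Fin.ext hib.symm)
    · simp
  · refine Finset.sum_eq_zero fun j _ => ?_
    rw [if_neg, mul_zero]
    have := j.2
    omega

theorem finInclusion_injective (n : ℕ) : Function.Injective (finInclusion n) := by
  rw [injective_iff_map_eq_zero]
  intro v hv
  ext i
  have := finInclusion_apply v i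
  rw [hv, dif_pos i.2] at this
  exact this.symm

theorem finInclusion_single {n : ℕ} : finInclusion (n + 1) (Pi.single 0 1) = vecE0 := by
  ext i
  rw [finInclusion_apply, vecE0, ← ell2Basis_apply, ell2Basis_coord]
  split_ifs with h1 h2 h2
  · subst h2; simp
  · rw [Pi.single_apply, if_neg]
    intro h; exact h2 (congrArg Fin.val h)
  · omega
  · rfl

/-- If `ρ_n = 0`, the first `n + 1` coordinates span an invariant subspace. -/
theorem cmvOperator_finInclusion {γ : ℕ → ℂ} (h : ∀ n, ‖γ n‖ ≤ 1) {n : ℕ}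
    (hn : cmvR γ (n + 1) = 0) (v : Fin (n + 1) → ℂ) :
    cmvOperator γ (finInclusion (n + 1) v)
      = finInclusion (n + 1) ((cmvCutoff γ (n + 1)).mulVec v) := by
  ext i
  have h1 : ∀ m, n < m → ∀ j, j ≤ n → cmvMatrix γ m j = 0 := by
    intro m hm j hj
    rcases Nat.even_or_odd' m with ⟨k, rfl | rfl⟩
    · rw [cmvMatrix_even]
      grind
    · rw [cmvMatrix_odd]
      grind
  have h2 : cmvOperator γ (finInclusion (n + 1) v) i
      = ∑ j ∈ Finset.range (n + 1), cmvMatrix γ i j * finInclusion (n + 1) v j := by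
    rw [cmvOperator_apply h]
    refine Finset.sum_congr_of_eq_on_inter ?_ ?_ fun _ _ _ => rfl
    · intro j _ hj
      rw [finInclusion_apply, dif_neg (by simpa using hj), mul_zero]
    · intro j _ hj
      rw [cmvMatrix_eq_zero, zero_mul]
      simp at hj; omega
  rw [h2, finInclusion_apply]
  split_ifs with hi
  · rw [Finset.sum_range, Matrix.mulVec, dotProduct]
    refine Finset.sum_congr rfl fun j _ => ?_
    rw [finInclusion_apply, dif_pos j.2]
    rfl
  · refine Finset.sum_eq_zero fun j hj => ?_
    rw [h1 i (by omega) j (by simpa using hj), zero_mul]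

theorem aeval_cmvOperator_finInclusion {γ : ℕ → ℂ} (h : ∀ n, ‖γ n‖ ≤ 1) {n : ℕ}
    (hn : cmvR γ (n + 1) = 0) (P : ℂ[X]) (v : Fin (n + 1) → ℂ) :
    aeval (cmvOperator γ) P (finInclusion (n + 1) v)
      = finInclusion (n + 1) ((aeval (cmvCutoff γ (n + 1)) P).mulVec v) := by
  have hpow (k : ℕ) : (cmvOperator γ ^ k) (finInclusion (n + 1) v)
      = finInclusion (n + 1) ((cmvCutoff γ (n + 1) ^ k).mulVec v) := by
    induction k with
    | zero => simp
    | succ k ih =>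
      rw [pow_succ', mul_apply_eq_comp, ih, cmvOperator_finInclusion h hn,
        Matrix.mulVec_mulVec, ← pow_succ']
  induction P using Polynomial.induction_on' with
  | add P Q hP hQ => simp [Matrix.add_mulVec, hP, hQ]
  | monomial k a =>
    rw [aeval_monomial, aeval_monomial, ← Algebra.smul_def, ← Algebra.smul_def,
      smul_apply, hpow, Matrix.smul_mulVec, map_smul]

theorem aeval_apply_of_eq_smul {T : Ell2 →L[ℂ] Ell2} {x : Ell2} {ω : ℂ} (hx : T x = ω • x)
    (P : ℂ[X]) : aeval T P x = P.eval ω • x := by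
  have hpow (k : ℕ) : (T ^ k) x = ω ^ k • x := by
    induction k with
    | zero => simp
    | succ k ih => rw [pow_succ', mul_apply_eq_comp, ih, map_smul, hx, smul_smul,
        ← pow_succ]
  induction P using Polynomial.induction_on' with
  | add P Q hP hQ => simp [add_smul, hP, hQ]
  | monomial k a =>
    rw [aeval_monomial, ← Algebra.smul_def, smul_apply, hpow, eval_monomial,
      smul_smul]

theorem cmvR_eq_zero {γ : ℕ → ℂ} {n : ℕ} (h : ‖γ n‖ = 1) : cmvR γ (n + 1) = 0 := by
  simp [cmvR, cmvA, h]

/-- The zeros of the POPUC lie on the unit circle. -/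
theorem norm_eq_one_of_popuc_eval_eq_zero {α : ℕ → ℂ} (h : ∀ n, ‖α n‖ ≤ 1) {β : ℂ} (hβ : ‖β‖ = 1)
    {n : ℕ} {z : ℂ} (hz : (popuc β α (n + 1)).eval z = 0) : ‖z‖ = 1 := by
  rw [← charpoly_cutoff_revSeq α hβ 1 n, Matrix.eval_charpoly,
    ← Matrix.exists_mulVec_eq_zero_iff] at hz
  -- An eigenvector of the finite block is an eigenvector of the isometric CMV operator. The
  -- continuation of the coefficients plays no role here, so ω = 1 is taken.
  obtain ⟨v, hv0, hv⟩ := hz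
  have hγ := norm_revSeq_le h hβ (norm_one (α := ℂ)) n
  have hR := cmvR_eq_zero (norm_revSeq_of_le α hβ (norm_one (α := ℂ)) (le_refl n))
  have h1 := cmvOperator_finInclusion hγ hR v
  have h2 : (cmvCutoff (revSeq α β 1 n) (n + 1)).mulVec v = z • v := by
    rw [Matrix.sub_mulVec, sub_eq_zero] at hv
    rw [← hv, Matrix.scalar_apply, ← Matrix.smul_one_eq_diagonal, Matrix.smul_mulVec,
      Matrix.one_mulVec]
  rw [h2, map_smul] at h1
  have h3 := norm_cmvOperator_apply hγ (finInclusion (n + 1) v)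
  rw [h1, norm_smul] at h3
  have h4 : finInclusion (n + 1) v ≠ 0 := fun h0 =>
    hv0 (finInclusion_injective _ (h0.trans (map_zero _).symm))
  exact mul_right_cancel₀ (norm_ne_zero_iff.2 h4) (h3.trans (one_mul _).symm)

theorem cmvOperator_revSeq_basis {α : ℕ → ℂ} (h : ∀ n, ‖α n‖ ≤ 1) {β ω : ℂ} (hβ : ‖β‖ = 1)
    (hω : ‖ω‖ = 1) {n l : ℕ} (hl : n < l) :
    cmvOperator (revSeq α β ω n) (ell2Basis l) = ω • ell2Basis l := by
  have hγ := norm_revSeq_le h hβ hω n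
  have hR : ∀ m, n < m → cmvR (revSeq α β ω n) m = 0 := by
    rintro (_ | m) hm
    · omega
    · exact cmvR_eq_zero (norm_revSeq_of_le α hβ hω (by omega))
  -- All ρ beyond the block vanish, so the operator is diagonal there with this product on the
  -- diagonal; the powers of -ω̄ in the coefficients are chosen to make it ω.
  have hA : -conj (cmvA (revSeq α β ω n) (l + 1)) * cmvA (revSeq α β ω n) l = ω := by
    obtain ⟨q, rfl⟩ : ∃ q, l = n + q + 1 := ⟨l - n - 1, by omega⟩
    have e1 := conj_mul_self_of_norm_eq_one hβ
    have e2 : conj (-conj ω) * (-conj ω) = 1 := conj_mul_self_of_norm_eq_one (by simpa using hω)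
    have e3 : (conj (-conj ω)) ^ q * (-conj ω) ^ q = 1 := by rw [← mul_pow, e2, one_pow]
    simp only [cmvA, revSeq]
    rw [if_neg (by omega), if_neg (by omega), show n + q + 1 - n = q + 1 by omega,
      show n + q - n = q by omega, map_mul, map_pow, pow_succ]
    have e4 : conj (-conj ω) = -ω := by simp
    rw [e4] at e3 ⊢
    linear_combination ω * (-ω) ^ q * (-conj ω) ^ q * e1 + ω * e3
  ext i
  rw [cmvOperator_basis_apply hγ, lp.coeFn_smul, Pi.smul_apply, ell2Basis_coord, smul_eq_mul]
  rcases Nat.even_or_odd' i with ⟨k, rfl | rfl⟩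
  · rw [cmvMatrix_even]
    grind
  · rw [cmvMatrix_odd]
    grind

/-- A finite reversed CMV matrix is, up to eigenvectors, a CMV operator; its `m`-function is a
ratio of a monic orthogonal polynomial and a POPUC. -/
theorem exists_reversed_cmvOperator {α : ℕ → ℂ} (h : ∀ n, ‖α n‖ ≤ 1) {β : ℂ} (hβ : ‖β‖ = 1)
    (n : ℕ) : ∃ γ : ℕ → ℂ, (∀ l, ‖γ l‖ ≤ 1) ∧ (∀ l < n, γ l = -conj (α (n - 1 - l)) * β) ∧
      (∀ w ∈ spectrum ℂ (cmvOperator γ), (popuc β α (n + 1)).eval w = 0) ∧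
      ∀ z, (popuc β α (n + 1)).eval z ≠ 0 →
        mFun γ z = (opuc α n).eval z / (popuc β α (n + 1)).eval z := by
  set P := popuc β α (n + 1) with hP
  have hdeg : P.degree ≠ 0 := by
    rw [hP, popuc, Matrix.charpoly_degree_eq_dim, Fintype.card_fin]
    exact_mod_cast Nat.succ_ne_zero n
  -- The eigenvalue on the remaining basis vectors is chosen among the zeros of P, so that the
  -- infinite continuation adds no spectrum outside these zeros.
  obtain ⟨ω, hω0⟩ := IsAlgClosed.exists_root P hdeg
  have hω : ‖ω‖ = 1 := norm_eq_one_of_popuc_eval_eq_zero h hβ hω0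
  have hγ := norm_revSeq_le h hβ hω n
  have hR := cmvR_eq_zero (norm_revSeq_of_le α hβ hω (le_refl n))
  have hspec : ∀ w ∈ spectrum ℂ (cmvOperator (revSeq α β ω n)), P.eval w = 0 := by
    -- P annihilates the block by Cayley–Hamilton and the other basis vectors because P(ω) = 0;
    -- spectral mapping then confines the spectrum to the zeros of P.
    have hzero : aeval (cmvOperator (revSeq α β ω n)) P = 0 := by
      have hdense : Dense (Submodule.span ℂ (Set.range ell2Basis) : Set Ell2) := by
        rw [Submodule.dense_iff_topologicalClosure_eq_top]
        exact ell2Basis.dense_span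
      refine ContinuousLinearMap.ext_on hdense ?_
      rintro _ ⟨l, rfl⟩
      rcases le_or_gt l n with hl | hl
      · have : ell2Basis l = finInclusion (n + 1) (Pi.single ⟨l, by omega⟩ 1) := by
          ext i
          rw [finInclusion_apply, ell2Basis_coord]
          split_ifs with h1 h2 h2
          · subst h1; simp
          · omega
          · rw [Pi.single_apply, if_neg]
            intro hh; exact h1 (congrArg Fin.val hh)
          · rfl
        rw [this, aeval_cmvOperator_finInclusion hγ hR, hP, ← charpoly_cutoff_revSeq α hβ ω n,
          Matrix.aeval_self_charpoly, Matrix.zero_mulVec, map_zero]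
        rfl
      · rw [aeval_apply_of_eq_smul (cmvOperator_revSeq_basis h hβ hω hl)]
        rw [show P.eval ω = 0 from hω0]
        simp
    intro w hw
    have h1 := spectrum.subset_polynomial_aeval (cmvOperator (revSeq α β ω n)) P ⟨w, hw, rfl⟩
    have : Nontrivial Ell2 := ⟨⟨ell2Basis 0, 0, ell2Basis.orthonormal.ne_zero 0⟩⟩
    rw [hzero, spectrum.zero_eq] at h1
    exact h1
  refine ⟨revSeq α β ω n, hγ, fun l hl => by rw [revSeq, if_pos hl], hspec, fun z hz => ?_⟩
  have hres : z ∈ resolventSet ℂ (cmvOperator (revSeq α β ω n)) := by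
    by_contra hc
    exact hz (hspec z hc)
  set U := Matrix.scalar _ z - cmvCutoff (revSeq α β ω n) (n + 1) with hU
  have hdet : U.det = P.eval z := by
    rw [hP, ← charpoly_cutoff_revSeq α hβ ω n, Matrix.eval_charpoly]
  -- Cramer's rule: the first column of the inverse of the finite matrix. Its inclusion into ℓ² is
  -- the resolvent applied to e_0.
  let v : Fin (n + 1) → ℂ := fun i => U.adjugate i 0 / P.eval z
  have hv : U.mulVec v = Pi.single 0 1 := by
    have h1 : v = (P.eval z)⁻¹ • U.adjugate.mulVec (Pi.single 0 1) := by
      ext i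
      simp [v, div_eq_inv_mul]
    rw [h1, Matrix.mulVec_smul, Matrix.mulVec_mulVec, Matrix.mul_adjugate, hdet,
      Matrix.smul_mulVec, Matrix.one_mulVec, smul_smul, inv_mul_cancel₀ hz, one_smul]
  have hx : z • finInclusion (n + 1) v - cmvOperator (revSeq α β ω n) (finInclusion (n + 1) v)
      = vecE0 := by
    rw [cmvOperator_finInclusion hγ hR, ← map_smul, ← map_sub, ← finInclusion_single (n := n), ← hv,
      hU, Matrix.sub_mulVec, Matrix.scalar_apply, ← Matrix.smul_one_eq_diagonal,
      Matrix.smul_mulVec, Matrix.one_mulVec]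
  rw [mFun]
  have h2 := resolvent_sub_apply hres (finInclusion (n + 1) v)
  rw [hx] at h2
  rw [h2, vecE0, lp.inner_single_left, finInclusion_apply, dif_pos (Nat.succ_pos n)]
  have h3 : U.adjugate 0 0 = (opuc α n).eval z := adjugate_cutoff_revSeq α hβ ω n z
  simp [v, h3]

/-! ### Sequences with a limiting ratio -/

theorem RatioSeq.congr_add {t : ℝ} {n n' N : ℕ → ℕ} (h : RatioSeq t n N) (c : ℤ)
    (hn : ∀ᶠ i in atTop, (n' i : ℤ) = n i + c) : RatioSeq t n' N := by
  obtain ⟨h1, h2, h3⟩ := h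
  refine ⟨?_, h2, ?_⟩
  · have h4 : Tendsto (fun i => (n i : ℤ) + c) atTop atTop :=
      tendsto_atTop_add_const_right _ _ (tendsto_natCast_atTop_atTop.comp h1)
    rw [← tendsto_natCast_atTop_iff (R := ℤ)]
    exact h4.congr' (hn.mono fun i hi => hi.symm)
  · have h5 : Tendsto (fun i => (c : ℝ) / (N i : ℝ)) atTop (𝓝 0) :=
      tendsto_const_nhds.div_atTop (tendsto_natCast_atTop_atTop.comp h2)
    have h6 := h3.add h5
    rw [add_zero] at h6
    refine h6.congr' (hn.mono fun i hi => ?_)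
    have : (n' i : ℝ) = n i + c := by exact_mod_cast hi
    simp only [this, add_div]

theorem exists_ratioSeq {p : ℕ} (hp : 1 ≤ p) {t : ℝ} (ht : 0 < t) :
    ∃ k N : ℕ → ℕ, RatioSeq t (fun i => k i * p) N := by
  have hp' : (0 : ℝ) < p := by exact_mod_cast hp
  have h1 : Tendsto (fun i : ℕ => (t / p) * (i : ℝ)) atTop atTop :=
    tendsto_natCast_atTop_atTop.const_mul_atTop (by positivity)
  have h2 : Tendsto (fun i : ℕ => ⌊(t / p) * (i : ℝ)⌋₊) atTop atTop := tendsto_nat_floor_atTop.comp h1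
  refine ⟨fun i => ⌊(t / p) * (i : ℝ)⌋₊, fun i => i, ?_, tendsto_id, ?_⟩
  · exact tendsto_atTop_mono (fun i => Nat.le_mul_of_pos_right _ hp) h2
  · have h3 := ((tendsto_nat_floor_mul_div_atTop (R := ℝ) (a := t / p) (by positivity)).comp
      tendsto_natCast_atTop_atTop).mul_const (p : ℝ)
    rw [div_mul_cancel₀ _ hp'.ne'] at h3
    refine h3.congr fun i => ?_
    simp only [Function.comp, Nat.cast_mul]
    ring

/-- Coefficients that converge to a `p`-periodic sequence along `k p / N → t`. -/
structure PeriodicLimit (p : ℕ) (t : ℝ) (α : ℕ → ℕ → ℂ) (a : ℤ → ℂ) : Prop where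
  one_le : 1 ≤ p
  pos : 0 < t
  norm_le : ∀ n N, ‖α n N‖ ≤ 1
  norm_limit_le : ∀ n, ‖a n‖ ≤ 1
  periodic : ∀ n, a (n + p) = a n
  lim : ∀ j < p, ∀ k N : ℕ → ℕ, RatioSeq t (fun i => k i * p) N →
    Tendsto (fun i => α (k i * p + j) (N i)) atTop (𝓝 (a j))

section

variable {p : ℕ} {t : ℝ} {α : ℕ → ℕ → ℂ} {a : ℤ → ℂ}

theorem PeriodicLimit.periodic_sub (h : PeriodicLimit p t α a) (n : ℤ) (c : ℕ) :
    a (n - c * p) = a n := by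
  induction c with
  | zero => simp
  | succ c ih =>
    rw [← h.periodic (n - (c + 1 : ℕ) * p), ← ih]
    congr 1
    push_cast; ring

theorem RatioSeq.eventually_le {k N : ℕ → ℕ} (hs : RatioSeq t (fun i => k i * p) N) (s : ℕ) :
    ∀ᶠ i in atTop, s ≤ k i * p :=
  hs.1.eventually_ge_atTop s

theorem RatioSeq.sub {k N : ℕ → ℕ} (hs : RatioSeq t (fun i => k i * p) N) (s c : ℕ) :
    RatioSeq t (fun i => k i * p - s + c) N :=
  hs.congr_add (c - s) (by filter_upwards [hs.eventually_le s] with i hi; omega)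

theorem PeriodicLimit.tendsto_sub (h : PeriodicLimit p t α a) {k N : ℕ → ℕ}
    (hs : RatioSeq t (fun i => k i * p) N) (s : ℕ) :
    Tendsto (fun i => α (k i * p - s) (N i)) atTop (𝓝 (a (-s))) := by
  have hp := h.one_le
  -- Writing kp - s = (k - c)p + r with 0 ≤ r < p reduces the claim to the assumed limits; replacing
  -- k by k - c does not change the limiting ratio.
  obtain ⟨c, r, hr, hc⟩ : ∃ c r : ℕ, r < p ∧ s + r = c * p := by
    refine ⟨(s + (p - 1)) / p, (p - 1) - (s + (p - 1)) % p, by omega, ?_⟩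
    have h1 := Nat.div_add_mod (s + (p - 1)) p
    have h2 := Nat.mod_lt (s + (p - 1)) hp
    rw [mul_comm p] at h1
    omega
  have hs' : RatioSeq t (fun i => (k i - c) * p) N := by
    refine hs.congr_add (-(c * p : ℕ)) ?_
    filter_upwards [hs.eventually_le (c * p)] with i hi
    rw [Nat.sub_mul]; omega
  have h1 := h.lim r hr _ N hs'
  have h2 : a (-s) = a r := by
    rw [← h.periodic_sub r c]
    congr 1
    have : (s : ℤ) + r = c * p := by exact_mod_cast hc
    linarith
  rw [h2]
  refine h1.congr' ?_
  filter_upwards [hs.eventually_le (c * p)] with i hi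
  congr 1
  rw [Nat.sub_mul]; omega

theorem PeriodicLimit.norm_revCoeff_le (h : PeriodicLimit p t α a) {β : ℂ} (hβ : ‖β‖ = 1)
    (j n : ℕ) : ‖revCoeff p a β j n‖ ≤ 1 := by
  rw [revCoeff, norm_mul, norm_neg, RCLike.norm_conj, hβ, mul_one]
  exact h.norm_limit_le _

/-! ### Convergence to the m-functions of the periodic matrices -/

/-- Away from the limit points of zeros, the zeros of the POPUC keep a positive distance. -/
theorem exists_le_dist_zeros (h : PeriodicLimit p t α a) {k N : ℕ → ℕ}
    (hs : RatioSeq t (fun i => k i * p) N) {β : ℂ} (hβ : ‖β‖ = 1) (j : ℕ) {z : ℂ}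
    (hz : z ∉ limZeros α β t) :
    ∃ δ > 0, ∀ᶠ i in atTop, ∀ w,
      (popuc β (fun l => α l (N i)) (k i * p - j + 1)).eval w = 0 → δ ≤ ‖z - w‖ := by
  by_cases hz1 : ‖z‖ = 1
  · have h1 : liminf (fun i => Metric.infEDist z
        (popucZeros β (fun l => α l (N i)) (k i * p - j + 1))) atTop ≠ 0 :=
      fun h0 => hz ⟨hz1, _, N, hs.sub j 1, h0⟩
    obtain ⟨ε, hε0, hε⟩ := exists_between (pos_iff_ne_zero.2 h1)
    have hεt : ε ≠ ⊤ := hε.ne_top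
    refine ⟨ε.toReal, ENNReal.toReal_pos hε0.ne' hεt, ?_⟩
    filter_upwards [eventually_lt_of_lt_liminf hε] with i hi w hw
    have hw1 := norm_eq_one_of_popuc_eval_eq_zero (fun n => h.norm_le n (N i)) hβ hw
    have h2 : Metric.infEDist z (popucZeros β (fun l => α l (N i)) (k i * p - j + 1)) ≤ edist z w :=
      Metric.infEDist_le_edist_of_mem ⟨hw1, hw⟩
    rw [← dist_eq_norm, dist_edist]
    exact ENNReal.toReal_mono (edist_ne_top _ _) (hi.le.trans h2)
  -- Off the unit circle the distance to the circle works, since all zeros lie on it.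
  · refine ⟨|‖z‖ - 1|, abs_pos.2 (sub_ne_zero.2 hz1), Eventually.of_forall fun i w hw => ?_⟩
    have hw1 := norm_eq_one_of_popuc_eval_eq_zero (fun n => h.norm_le n (N i)) hβ hw
    have := abs_norm_sub_norm_le z w
    rwa [hw1] at this

/-- The analytic core. The quotient is the m-function of a reversed CMV operator; these operators
converge strongly to the periodic one, and their spectra stay away from z. Convergence is stated
along `atTop ×ˢ 𝓝 z` because this form passes through the later algebra and yields uniformity on
compacts. -/
theorem tendsto_opuc_div_popuc (h : PeriodicLimit p t α a) {k N : ℕ → ℕ}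
    (hs : RatioSeq t (fun i => k i * p) N) {β : ℂ} (hβ : ‖β‖ = 1) (j : ℕ) {z : ℂ}
    (hz : z ∉ limZeros α β t) :
    z ∈ resolventSet ℂ (cmvOperator (revCoeff p a β j)) ∧
    (∀ᶠ q : ℕ × ℂ in atTop ×ˢ 𝓝 z,
      (popuc β (fun l => α l (N q.1)) (k q.1 * p - j + 1)).eval q.2 ≠ 0) ∧
    Tendsto (fun q : ℕ × ℂ => (opuc (fun l => α l (N q.1)) (k q.1 * p - j)).eval q.2 /
      (popuc β (fun l => α l (N q.1)) (k q.1 * p - j + 1)).eval q.2)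
      (atTop ×ˢ 𝓝 z) (𝓝 (mFun (revCoeff p a β j) z)) := by
  obtain ⟨δ, hδ, hdist⟩ := exists_le_dist_zeros h hs hβ j hz
  choose γ hγ1 hγ2 hγ3 hγ4 using fun i =>
    exists_reversed_cmvOperator (fun n => h.norm_le n (N i)) hβ (k i * p - j)
  have hrev := h.norm_revCoeff_le hβ j
  have hγlim (l : ℕ) : Tendsto (fun i => γ i l) atTop (𝓝 (revCoeff p a β j l)) := by
    have h1 := h.tendsto_sub hs (j + 1 + l)
    have h2 : a (-(j + 1 + l : ℕ)) = a ((p : ℤ) - 1 - ((l + j : ℕ) : ℤ)) := by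
      rw [← h.periodic]
      congr 1
      push_cast; ring
    rw [h2] at h1
    refine (((Complex.continuous_conj.tendsto _).comp h1).neg.mul_const β).congr' ?_
    filter_upwards [hs.eventually_le (j + l + 1)] with i hi
    rw [hγ2 i l (by omega)]
    simp only [Function.comp]
    congr 4
    omega
  have hT (i : ℕ) := isStarNormal_of_mem_unitary (cmvOperator_mem_unitary (hγ1 i))
  have hT' := isStarNormal_of_mem_unitary (cmvOperator_mem_unitary hrev)
  have hd : ∀ᶠ i in atTop, ∀ w ∈ spectrum ℂ (cmvOperator (γ i)), δ ≤ ‖z - w‖ :=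
    hdist.mono fun i hi w hw => hi w (hγ3 i w hw)
  obtain ⟨h1, h2⟩ := tendsto_inner_resolvent hT hT'
    (tendsto_cmvOperator_apply hγ1 hrev hγlim) hδ hd vecE0
  have hne : ∀ᶠ q : ℕ × ℂ in atTop ×ˢ 𝓝 z,
      (popuc β (fun l => α l (N q.1)) (k q.1 * p - j + 1)).eval q.2 ≠ 0 := by
    filter_upwards [hdist.prod_mk (Metric.ball_mem_nhds z hδ)] with q hq h0
    have h3 := hq.1 q.2 h0
    have h4 : dist q.2 z < δ := hq.2
    rw [dist_comm, dist_eq_norm] at h4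
    linarith
  refine ⟨h1, hne, h2.congr' ?_⟩
  filter_upwards [hne] with q hq
  exact hγ4 q.1 q.2 hq

/-- Uniform convergence on compact sets from joint convergence at each point. -/
theorem ratioLimit_of_tendsto {num den : ℕ → ℕ → ℂ[X]} {L : ℂ → ℂ} {U : Set ℂ}
    (h : ∀ k N : ℕ → ℕ, RatioSeq t (fun i => k i * p) N → ∀ z ∈ U,
      (∀ᶠ q : ℕ × ℂ in atTop ×ˢ 𝓝 z, (den (k q.1) (N q.1)).eval q.2 ≠ 0) ∧
      Tendsto (fun q : ℕ × ℂ => (num (k q.1) (N q.1)).eval q.2 / (den (k q.1) (N q.1)).eval q.2)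
        (atTop ×ˢ 𝓝 z) (𝓝 (L z))) : RatioLimit p t num den L U := by
  intro k N hs K hKU hK
  constructor
  · have : ∀ᶠ q : ℕ × ℂ in atTop ×ˢ 𝓝ˢ K, (den (k q.1) (N q.1)).eval q.2 ≠ 0 := by
      rw [hK.prod_nhdsSet_eq_biSup]
      simp only [eventually_iSup]
      exact fun z hz => (h k N hs z (hKU hz)).1
    obtain ⟨pa, hpa, pb, hpb, hab⟩ := eventually_prod_iff.1 this
    filter_upwards [hpa] with i hi z hz
    exact hab hi (hpb.self_of_nhdsSet z hz)
  · have hpt (z : ℂ) (hz : z ∈ K) : Tendsto (fun i => (num (k i) (N i)).eval z /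
        (den (k i) (N i)).eval z) atTop (𝓝 (L z)) := by
      have h1 : Tendsto (fun i : ℕ => (i, z)) atTop (atTop ×ˢ 𝓝 z) :=
        tendsto_id.prodMk tendsto_const_nhds
      exact (h k N hs z (hKU hz)).2.comp h1
    rw [← tendstoLocallyUniformlyOn_iff_tendstoUniformlyOn_of_compact hK]
    rw [Metric.tendstoLocallyUniformlyOn_iff]
    intro ε hε z hz
    have h1 := (h k N hs z (hKU hz)).2
    have h2 : ∀ᶠ q : ℕ × ℂ in atTop ×ˢ 𝓝 z, dist ((num (k q.1) (N q.1)).eval q.2 /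
        (den (k q.1) (N q.1)).eval q.2) (L z) < ε / 2 :=
      Metric.tendsto_nhds.1 h1 _ (half_pos hε)
    rw [eventually_prod_iff] at h2
    obtain ⟨pa, hpa, pb, hpb, hab⟩ := h2
    refine ⟨{w | pb w} ∩ K, inter_mem (mem_nhdsWithin_of_mem_nhds hpb) self_mem_nhdsWithin, ?_⟩
    filter_upwards [hpa] with i hi w hw
    -- Continuity of L need not be assumed: L w is a limit of the same quotients at w, which are all
    -- within ε/2 of L z.
    have h3 : dist (L w) (L z) ≤ ε / 2 := by
      refine le_of_tendsto ((hpt w hw.2).dist tendsto_const_nhds) ?_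
      filter_upwards [hpa] with i hi
      exact (hab hi hw.1).le
    have h4 := hab hi hw.1
    have h5 := dist_triangle_right (L w) ((num (k i) (N i)).eval w / (den (k i) (N i)).eval w) (L z)
    linarith

end

/-! ### The `m`-function and the Schur function of a CMV operator -/

theorem norm_vecE0 : ‖vecE0‖ = 1 := by
  rw [vecE0, ← ell2Basis_apply]
  exact ell2Basis.orthonormal.1 0

instance nontrivial_ell2 : Nontrivial Ell2 :=
  ⟨⟨vecE0, 0, fun h => by simpa [h] using norm_vecE0⟩⟩

theorem mem_resolventSet_cmvOperator {γ : ℕ → ℂ} (h : ∀ n, ‖γ n‖ ≤ 1) {z : ℂ} (hz : ‖z‖ ≠ 1) :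
    z ∈ resolventSet ℂ (cmvOperator γ) := by
  by_contra hc
  exact hz (spectrum.norm_eq_one_of_unitary (cmvOperator_mem_unitary h) hc)

/-- If m = 0, then `norm_sq_resolvent_apply` would read 0 = 1 + (|z|² - 1)‖x‖², which is impossible
for |z| ≥ 1. -/
theorem mFun_ne_zero {γ : ℕ → ℂ} (h : ∀ n, ‖γ n‖ ≤ 1) {z : ℂ}
    (hz : z ∈ resolventSet ℂ (cmvOperator γ)) (h1 : 1 ≤ ‖z‖) : mFun γ z ≠ 0 := by
  intro h0
  have := norm_sq_resolvent_apply (norm_cmvOperator_apply h) hz vecE0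
  rw [show inner ℂ vecE0 (resolvent (cmvOperator γ) z vecE0) = mFun γ z from rfl, h0,
    norm_vecE0] at this
  simp only [mul_zero, Complex.zero_re] at this
  have h2 : 0 ≤ ‖z‖ ^ 2 - 1 := by nlinarith
  nlinarith [mul_nonneg h2 (sq_nonneg ‖resolvent (cmvOperator γ) z vecE0‖)]

/-- If z m = 1, then the same identity would read 2 = 1 + (|z|² - 1)‖x‖², which is impossible for
|z| ≤ 1. -/
theorem mul_mFun_ne_one {γ : ℕ → ℂ} (h : ∀ n, ‖γ n‖ ≤ 1) {z : ℂ}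
    (hz : z ∈ resolventSet ℂ (cmvOperator γ)) (h1 : ‖z‖ ≤ 1) : z * mFun γ z ≠ 1 := by
  intro h0
  have := norm_sq_resolvent_apply (norm_cmvOperator_apply h) hz vecE0
  rw [show inner ℂ vecE0 (resolvent (cmvOperator γ) z vecE0) = mFun γ z from rfl, h0,
    norm_vecE0] at this
  simp only [Complex.one_re] at this
  have h2 : 0 ≤ 1 - ‖z‖ ^ 2 := by nlinarith [norm_nonneg z]
  nlinarith [mul_nonneg h2 (sq_nonneg ‖resolvent (cmvOperator γ) z vecE0‖)]

theorem conj_mFun_inv {γ : ℕ → ℂ} (h : ∀ n, ‖γ n‖ ≤ 1) {z : ℂ}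
    (hz : z ∈ resolventSet ℂ (cmvOperator γ)) (hz0 : z ≠ 0) :
    conj (mFun γ (conj z)⁻¹) = z * (1 - z * mFun γ z) :=
  conj_inner_resolvent_inv (cmvOperator_mem_unitary h) hz hz0 vecE0 norm_vecE0

theorem analyticAt_mFun {γ : ℕ → ℂ} {z : ℂ} (hz : z ∈ resolventSet ℂ (cmvOperator γ)) :
    AnalyticAt ℂ (mFun γ) z := by
  have hd : DifferentiableOn ℂ (mFun γ) (resolventSet ℂ (cmvOperator γ)) := by
    intro w hw
    have h1 := (spectrum.hasDerivAt_resolvent_const_left hw).clm_apply (hasDerivAt_const w vecE0)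
    have h2 := ((innerSL ℂ vecE0).hasFDerivAt.comp_hasDerivAt w h1)
    exact h2.differentiableAt.differentiableWithinAt
  exact hd.analyticAt ((spectrum.isOpen_resolventSet _).mem_nhds hz)

theorem caraFun_eq {γ : ℕ → ℂ} {z : ℂ} (hz : z ∈ resolventSet ℂ (cmvOperator γ)) :
    caraFun γ z = 1 - 2 * (z * mFun γ z) := by
  have h1 : Ring.inverse (cmvOperator γ - algebraMap ℂ (Ell2 →L[ℂ] Ell2) z)
      = -resolvent (cmvOperator γ) z := by
    obtain ⟨u, hu⟩ : IsUnit (algebraMap ℂ (Ell2 →L[ℂ] Ell2) z - cmvOperator γ) := hz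
    rw [resolvent, ← neg_sub, ← hu, ← Units.val_neg, Ring.inverse_unit, Ring.inverse_unit]
    simp
  have h2 := sub_apply_resolvent hz vecE0
  have h3 : cmvOperator γ (resolvent (cmvOperator γ) z vecE0)
      = z • resolvent (cmvOperator γ) z vecE0 - vecE0 := by
    rw [eq_sub_iff_add_eq, ← eq_sub_iff_add_eq', h2]
  have h4 : ((cmvOperator γ + algebraMap ℂ (Ell2 →L[ℂ] Ell2) z) *
      -resolvent (cmvOperator γ) z) vecE0
      = vecE0 - (2 * z) • resolvent (cmvOperator γ) z vecE0 := by
    have : ((cmvOperator γ + algebraMap ℂ (Ell2 →L[ℂ] Ell2) z) *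
      -resolvent (cmvOperator γ) z) vecE0 = -(cmvOperator γ (resolvent (cmvOperator γ) z vecE0)
        + z • resolvent (cmvOperator γ) z vecE0) := by
      simp [Algebra.algebraMap_eq_smul_one]
    rw [this, h3]
    module
  rw [caraFun, h1, h4, inner_sub_right, inner_smul_right, inner_self_eq_norm_sq_to_K, norm_vecE0,
    mFun]
  simp
  ring

theorem schurQuot_eq {γ : ℕ → ℂ} {z : ℂ} (hz : z ∈ resolventSet ℂ (cmvOperator γ)) (hz0 : z ≠ 0) :
    schurQuot γ z = if z * mFun γ z = 1 then OnePoint.infty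
      else ((mFun γ z / (z * mFun γ z - 1) : ℂ) : OnePoint ℂ) := by
  have h1 : caraFun γ z = -1 ↔ z * mFun γ z = 1 := by
    rw [caraFun_eq hz]
    constructor
    · intro h; linear_combination -h / 2
    · intro h; linear_combination -2 * h
  rw [schurQuot]
  simp only [h1]
  split_ifs with h2
  · rfl
  · congr 1
    rw [caraFun_eq hz]
    have h3 : z * mFun γ z - 1 ≠ 0 := sub_ne_zero.2 h2
    rw [show 1 - 2 * (z * mFun γ z) + 1 = -2 * (z * mFun γ z - 1) by ring]
    field_simp
    ring

theorem dense_norm_ne_one : Dense {w : ℂ | ‖w‖ ≠ 1 ∧ w ≠ 0} := by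
  have h1 : Dense (Metric.sphere (0 : ℂ) 1)ᶜ := by
    rw [← interior_eq_empty_iff_dense_compl, interior_sphere _ one_ne_zero]
  have h2 := h1.inter_of_isOpen_left (dense_compl_singleton (0 : ℂ)) Metric.isClosed_sphere.isOpen_compl
  convert h2 using 1
  ext w
  simp

/-! ### Limits of ratios -/

section Algebra

variable {ι : Type*} {l : Filter ι} {A B P Z : ι → ℂ} {β m z : ℂ}

/-- In this and the next two lemmas A, B, P stand for the values of Φ_n, Φ_n^* and the POPUC of
degree n + 1, and Z for the variable point near z. -/
theorem tendsto_star_div (hβ : ‖β‖ = 1) (hP : ∀ᶠ i in l, P i ≠ 0)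
    (hPeq : ∀ i, P i = Z i * A i - conj β * B i) (hZ : Tendsto Z l (𝓝 z))
    (hm : Tendsto (fun i => A i / P i) l (𝓝 m)) :
    Tendsto (fun i => B i / P i) l (𝓝 (β * (z * m - 1))) := by
  have hβ' := conj_mul_self_of_norm_eq_one hβ
  refine (((hZ.mul hm).sub_const 1).const_mul β).congr' ?_
  filter_upwards [hP] with i hi
  rw [eq_div_iff hi]
  field_simp
  rw [hPeq i]
  linear_combination B i * hβ'

theorem ratio_star_limit (hβ : ‖β‖ = 1) (hP : ∀ᶠ i in l, P i ≠ 0)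
    (hPeq : ∀ i, P i = Z i * A i - conj β * B i) (hZ : Tendsto Z l (𝓝 z))
    (hm : Tendsto (fun i => A i / P i) l (𝓝 m)) (hzm : z * m ≠ 1) :
    (∀ᶠ i in l, B i ≠ 0) ∧
      Tendsto (fun i => A i / B i) l (𝓝 (conj β * (m / (z * m - 1)))) ∧
      Tendsto (fun i => P i / B i) l (𝓝 (conj β / (z * m - 1))) := by
  have hβ' := conj_mul_self_of_norm_eq_one hβ
  have hβ0 : β ≠ 0 := by rintro rfl; simp at hβ
  have h1 := tendsto_star_div hβ hP hPeq hZ hm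
  have h0 : z * m - 1 ≠ 0 := sub_ne_zero.2 hzm
  have hne : β * (z * m - 1) ≠ 0 := mul_ne_zero hβ0 h0
  have hB : ∀ᶠ i in l, B i ≠ 0 := by
    filter_upwards [h1.eventually_ne hne] with i hi h0
    rw [h0, zero_div] at hi
    exact hi rfl
  have hinv : conj β = β⁻¹ := eq_inv_of_mul_eq_one_left hβ'
  refine ⟨hB, ?_, ?_⟩
  · have h2 := hm.div h1 hne
    have h3 : m / (β * (z * m - 1)) = conj β * (m / (z * m - 1)) := by
      rw [hinv]; field_simp
    rw [h3] at h2
    refine h2.congr' ?_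
    filter_upwards [hP, hB] with i hi hi'
    simp only [Pi.div_apply]
    field_simp
  · have h2 := h1.inv₀ hne
    have h3 : (β * (z * m - 1))⁻¹ = conj β / (z * m - 1) := by
      rw [hinv]; field_simp
    rw [h3] at h2
    exact h2.congr fun i => inv_div _ _

theorem ratio_limit (hβ : ‖β‖ = 1) (hP : ∀ᶠ i in l, P i ≠ 0)
    (hPeq : ∀ i, P i = Z i * A i - conj β * B i) (hZ : Tendsto Z l (𝓝 z))
    (hm : Tendsto (fun i => A i / P i) l (𝓝 m)) (hm0 : m ≠ 0) :
    (∀ᶠ i in l, A i ≠ 0) ∧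
      Tendsto (fun i => B i / A i) l (𝓝 (β * ((z * m - 1) / m))) ∧
      Tendsto (fun i => P i / A i) l (𝓝 m⁻¹) := by
  have h1 := tendsto_star_div hβ hP hPeq hZ hm
  have hA : ∀ᶠ i in l, A i ≠ 0 := by
    filter_upwards [hm.eventually_ne hm0] with i hi h0
    rw [h0, zero_div] at hi
    exact hi rfl
  refine ⟨hA, ?_, ?_⟩
  · have h2 := h1.div hm hm0
    rw [mul_div_assoc] at h2
    refine h2.congr' ?_
    filter_upwards [hP, hA] with i hi hi'
    simp only [Pi.div_apply]
    field_simp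
  · exact (hm.inv₀ hm0).congr fun i => inv_div _ _

end Algebra

/-! ### The m-functions for different β and the Schur function -/

section

variable {p : ℕ} {t : ℝ} {α : ℕ → ℕ → ℂ} {a : ℤ → ℂ}

theorem not_mem_limZeros_of_norm_ne_one {β : ℂ} {z : ℂ} (hz : ‖z‖ ≠ 1) : z ∉ limZeros α β t :=
  fun h => hz h.1

theorem PeriodicLimit.popuc_eval (h : PeriodicLimit p t α a) {β : ℂ} (hβ : ‖β‖ = 1) (n N : ℕ)
    (z : ℂ) : (popuc β (fun l => α l N) (n + 1)).eval z
      = z * (opuc (fun l => α l N) n).eval z - conj β * (opucStar (fun l => α l N) n).eval z := by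
  rw [popuc_succ (fun l => h.norm_le l N) hβ]
  simp

theorem PeriodicLimit.opuc_eval (h : PeriodicLimit p t α a) (n N : ℕ)
    (z : ℂ) : (opuc (fun l => α l N) (n + 1)).eval z
      = z * (opuc (fun l => α l N) n).eval z
        - conj (α n N) * (opucStar (fun l => α l N) n).eval z := by
  rw [opuc_succ (fun l => h.norm_le l N)]
  simp

theorem PeriodicLimit.opucStar_eval (h : PeriodicLimit p t α a) (n N : ℕ)
    (z : ℂ) : (opucStar (fun l => α l N) (n + 1)).eval z
      = (opucStar (fun l => α l N) n).eval z - α n N * (z * (opuc (fun l => α l N) n).eval z) := by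
  rw [opucStar_succ (fun l => h.norm_le l N)]
  simp

/-- Both m-functions are limits of quotients built from the same Φ_n and Φ_n^*, and the relation
holds exactly before the limit. In cross-multiplied form it needs no nonvanishing of the limits. -/
theorem PeriodicLimit.mFun_relation_of_norm_ne_one (h : PeriodicLimit p t α a) {β : ℂ}
    (hβ : ‖β‖ = 1) (j : ℕ) {z : ℂ} (hz : ‖z‖ ≠ 1) :
    mFun (revCoeff p a 1 j) z * (z * mFun (revCoeff p a β j) z - 1)
      = conj β * mFun (revCoeff p a β j) z * (z * mFun (revCoeff p a 1 j) z - 1) := by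
  obtain ⟨k, N, hs⟩ := exists_ratioSeq h.one_le h.pos
  have hbase : Tendsto (fun i : ℕ => (i, z)) atTop (atTop ×ˢ 𝓝 z) :=
    tendsto_id.prodMk tendsto_const_nhds
  have key {β : ℂ} (hβ : ‖β‖ = 1) := tendsto_opuc_div_popuc h hs hβ j
    (not_mem_limZeros_of_norm_ne_one hz)
  obtain ⟨-, e1, e2⟩ := key hβ
  obtain ⟨-, f1, f2⟩ := key (norm_one (α := ℂ))
  replace e1 := hbase.eventually e1
  replace e2 := e2.comp hbase
  replace f1 := hbase.eventually f1
  replace f2 := f2.comp hbase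
  refine tendsto_nhds_unique (f2.mul ((e2.const_mul z).sub_const 1))
    (((e2.const_mul (conj β)).mul ((f2.const_mul z).sub_const 1)).congr' ?_)
  filter_upwards [e1, f1] with i hi hi'
  simp only [Function.comp] at *
  rw [h.popuc_eval hβ] at hi ⊢
  rw [h.popuc_eval norm_one] at hi' ⊢
  rw [map_one, one_mul] at hi' ⊢
  generalize (opuc (fun l => α l (N i)) (k i * p - j)).eval z = A at *
  generalize (opucStar (fun l => α l (N i)) (k i * p - j)).eval z = B at *
  generalize hP : z * A - conj β * B = P at *
  generalize hQ : z * A - B = Q at *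
  field_simp
  linear_combination A * (conj β * hQ - hP)

/-- Extension by continuity from the complement of the circle to the gaps of the spectra on the
circle. -/
theorem PeriodicLimit.mFun_relation (h : PeriodicLimit p t α a) {β : ℂ}
    (hβ : ‖β‖ = 1) (j : ℕ) {z : ℂ} (hz : z ∈ resolventSet ℂ (cmvOperator (revCoeff p a β j)))
    (hz1 : z ∈ resolventSet ℂ (cmvOperator (revCoeff p a 1 j))) :
    mFun (revCoeff p a 1 j) z * (z * mFun (revCoeff p a β j) z - 1)
      = conj β * mFun (revCoeff p a β j) z * (z * mFun (revCoeff p a 1 j) z - 1) := by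
  have c1 : Tendsto (mFun (revCoeff p a 1 j)) (𝓝[{w : ℂ | ‖w‖ ≠ 1 ∧ w ≠ 0}] z)
      (𝓝 (mFun (revCoeff p a 1 j) z)) :=
    (analyticAt_mFun hz1).continuousAt.mono_left nhdsWithin_le_nhds
  have cβ : Tendsto (mFun (revCoeff p a β j)) (𝓝[{w : ℂ | ‖w‖ ≠ 1 ∧ w ≠ 0}] z)
      (𝓝 (mFun (revCoeff p a β j) z)) :=
    (analyticAt_mFun hz).continuousAt.mono_left nhdsWithin_le_nhds
  have cz : Tendsto (fun w : ℂ => w) (𝓝[{w : ℂ | ‖w‖ ≠ 1 ∧ w ≠ 0}] z) (𝓝 z) :=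
    tendsto_id.mono_left nhdsWithin_le_nhds
  have : (𝓝[{w : ℂ | ‖w‖ ≠ 1 ∧ w ≠ 0}] z).NeBot :=
    mem_closure_iff_nhdsWithin_neBot.1 (dense_norm_ne_one z)
  refine tendsto_nhds_unique (c1.mul ((cz.mul cβ).sub_const 1))
    (((cβ.const_mul (conj β)).mul ((cz.mul c1).sub_const 1)).congr' ?_)
  filter_upwards [self_mem_nhdsWithin] with w hw
  exact (h.mFun_relation_of_norm_ne_one hβ j hw.1).symm

theorem PeriodicLimit.schurQuot_eq (h : PeriodicLimit p t α a) {β : ℂ}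
    (hβ : ‖β‖ = 1) (j : ℕ) {z : ℂ} (hz : z ∈ resolventSet ℂ (cmvOperator (revCoeff p a β j)))
    (hz1 : z ∈ resolventSet ℂ (cmvOperator (revCoeff p a 1 j))) (hz0 : z ≠ 0) :
    schurQuot (revCoeff p a 1 j) z = if z * mFun (revCoeff p a β j) z = 1 then OnePoint.infty
      else ((conj β * (mFun (revCoeff p a β j) z / (z * mFun (revCoeff p a β j) z - 1)) : ℂ) :
        OnePoint ℂ) := by
  have hrel := h.mFun_relation hβ j hz hz1
  have hβ0 : conj β ≠ 0 := by
    rw [← norm_ne_zero_iff, RCLike.norm_conj, hβ]; exact one_ne_zero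
  rw [_root_.schurQuot_eq hz1 hz0]
  set m := mFun (revCoeff p a β j) z
  set m' := mFun (revCoeff p a 1 j) z
  have hiff : z * m' = 1 ↔ z * m = 1 := by
    constructor <;> intro h1
    · have : m' ≠ 0 := by rintro h0; rw [h0] at h1; simp at h1
      rw [h1, sub_self, mul_zero] at hrel
      exact sub_eq_zero.1 ((mul_eq_zero.1 hrel).resolve_left this)
    · have : m ≠ 0 := by rintro h0; rw [h0] at h1; simp at h1
      rw [h1, sub_self, mul_zero] at hrel
      exact sub_eq_zero.1 ((mul_eq_zero.1 hrel.symm).resolve_left (mul_ne_zero hβ0 this))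
  simp only [hiff]
  split_ifs with h1
  · rfl
  · congr 1
    have e1 : z * m - 1 ≠ 0 := sub_ne_zero.2 h1
    have e2 : z * m' - 1 ≠ 0 := sub_ne_zero.2 fun h2 => h1 (hiff.1 h2)
    rw [← mul_div_assoc, div_eq_div_iff e2 e1, hrel]

/-- The Schur function of the periodic matrix expressed by any of the `m`-functions. -/
theorem PeriodicLimit.schurFun_eq (h : PeriodicLimit p t α a) {β : ℂ}
    (hβ : ‖β‖ = 1) (j : ℕ) {z : ℂ} (hz : z ∈ resolventSet ℂ (cmvOperator (revCoeff p a β j))) :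
    schurFun (revCoeff p a 1 j) z = if z * mFun (revCoeff p a β j) z = 1 then OnePoint.infty
      else ((conj β * (mFun (revCoeff p a β j) z / (z * mFun (revCoeff p a β j) z - 1)) : ℂ) :
        OnePoint ℂ) := by
  have hn1 := h.norm_revCoeff_le (norm_one (α := ℂ)) j
  have hnβ := h.norm_revCoeff_le hβ j
  rw [schurFun]
  split_ifs with hS hone hone
  · rw [h.schurQuot_eq hβ j hz hS.1 hS.2, if_pos hone]
  · rw [h.schurQuot_eq hβ j hz hS.1 hS.2, if_neg hone]
  all_goals
    -- The exceptional points are 0 and points of the spectrum of 𝒞_1, all in the closed disk; there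
    -- z m_β ≠ 1, so the value ∞ does not occur.
    have hle : ‖z‖ ≤ 1 := by
      by_contra hgt
      refine hS ⟨mem_resolventSet_cmvOperator hn1 (by linarith), ?_⟩
      rintro rfl
      simp at hgt
  · exact absurd hone (mul_mFun_ne_one hnβ hz hle)
  · set S := resolventSet ℂ (cmvOperator (revCoeff p a 1 j)) \ {0}
    have hNe : (𝓝[S] z).NeBot := by
      refine mem_closure_iff_nhdsWithin_neBot.1 (dense_norm_ne_one.mono ?_ z)
      exact fun w hw => ⟨mem_resolventSet_cmvOperator hn1 hw.1, hw.2⟩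
    have cm := (analyticAt_mFun hz).continuousAt
    have hlim : ContinuousAt (fun w => conj β * (mFun (revCoeff p a β j) w /
        (w * mFun (revCoeff p a β j) w - 1))) z :=
      continuousAt_const.mul (cm.div ((continuousAt_id.mul cm).sub continuousAt_const)
        (sub_ne_zero.2 hone))
    have hlim' := (OnePoint.continuous_coe.tendsto _).comp hlim
    -- The expression in m_β is continuous at z even where that in m_1 is not defined, and so it
    -- gives the value of the continuous extension.
    refine Tendsto.limUnder_eq ((hlim'.mono_left nhdsWithin_le_nhds).congr' ?_)
    have hev : ∀ᶠ w in 𝓝[S] z, w ∈ resolventSet ℂ (cmvOperator (revCoeff p a β j)) :=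
      mem_nhdsWithin_of_mem_nhds ((spectrum.isOpen_resolventSet _).mem_nhds hz)
    have hev' : ∀ᶠ w in 𝓝[S] z, w * mFun (revCoeff p a β j) w ≠ 1 :=
      ((continuousAt_id.mul cm).eventually_ne hone).filter_mono nhdsWithin_le_nhds
    filter_upwards [hev, hev', self_mem_nhdsWithin] with w h1 h2 h3
    rw [h.schurQuot_eq hβ j h1 h3.1 h3.2, if_neg h2]
    rfl

end

section

variable {p : ℕ} {t : ℝ} {α : ℕ → ℕ → ℂ} {a : ℤ → ℂ}

/-! ### The Schur function away from the limit points of zeros -/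

theorem PeriodicLimit.mem_resolventSet (h : PeriodicLimit p t α a) {β : ℂ} (hβ : ‖β‖ = 1) (j : ℕ)
    {z : ℂ} (hz : z ∉ limZeros α β t) : z ∈ resolventSet ℂ (cmvOperator (revCoeff p a β j)) := by
  obtain ⟨k, N, hs⟩ := exists_ratioSeq h.one_le h.pos
  exact (tendsto_opuc_div_popuc h hs hβ j hz).1

/-- The equation z m_β = 1 would make f_1(z) infinite: a pole if |z| > 1, and impossible if |z| ≤ 1.
-/
theorem PeriodicLimit.mul_mFun_ne_one (h : PeriodicLimit p t α a) {β : ℂ} (hβ : ‖β‖ = 1) (j : ℕ)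
    {z : ℂ} (hz : z ∉ limZeros α β t) (hP : z ∉ poleSet (schurFun (revCoeff p a 1 j))) :
    z * mFun (revCoeff p a β j) z ≠ 1 := by
  intro h1
  have hres := h.mem_resolventSet hβ j hz
  refine hP ⟨?_, by rw [h.schurFun_eq hβ j hres, if_pos h1]⟩
  by_contra hle
  exact _root_.mul_mFun_ne_one (h.norm_revCoeff_le hβ j) hres (not_lt.1 hle) h1

theorem PeriodicLimit.mFun_ne_zero (h : PeriodicLimit p t α a) {β : ℂ} (hβ : ‖β‖ = 1) (j : ℕ)
    {z : ℂ} (hz : z ∉ limZeros α β t) (hZ : z ∉ zeroSet (schurFun (revCoeff p a 1 j))) :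
    mFun (revCoeff p a β j) z ≠ 0 := by
  intro h1
  have hres := h.mem_resolventSet hβ j hz
  refine hZ ⟨?_, by rw [h.schurFun_eq hβ j hres, h1]; simp⟩
  by_contra hle
  exact _root_.mFun_ne_zero (h.norm_revCoeff_le hβ j) hres (not_lt.1 hle) h1

theorem PeriodicLimit.finVal_schurFun (h : PeriodicLimit p t α a) {β : ℂ} (hβ : ‖β‖ = 1) (j : ℕ)
    {z : ℂ} (hz : z ∉ limZeros α β t) (h1 : z * mFun (revCoeff p a β j) z ≠ 1) :
    finVal (schurFun (revCoeff p a 1 j) z)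
      = conj β * (mFun (revCoeff p a β j) z / (z * mFun (revCoeff p a β j) z - 1)) := by
  rw [h.schurFun_eq hβ j (h.mem_resolventSet hβ j hz), if_neg h1]
  rfl

theorem PeriodicLimit.recipVal_schurFun (h : PeriodicLimit p t α a) {β : ℂ} (hβ : ‖β‖ = 1) (j : ℕ)
    {z : ℂ} (hz : z ∉ limZeros α β t) :
    recipVal (schurFun (revCoeff p a 1 j) z)
      = β * ((z * mFun (revCoeff p a β j) z - 1) / mFun (revCoeff p a β j) z) := by
  rw [h.schurFun_eq hβ j (h.mem_resolventSet hβ j hz)]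
  split_ifs with h1
  -- At f_1 = ∞ both sides are 0. At m_β = 0 they agree as well, through the convention that
  -- division by 0 gives 0.
  · rw [h1]; simp [recipVal]
  · change (_ : ℂ)⁻¹ = _
    rw [mul_inv, inv_div, eq_inv_of_mul_eq_one_left (conj_mul_self_of_norm_eq_one hβ), inv_inv]

theorem exists_not_mem_limZeros {z : ℂ} (hz : z ∉ limZerosAll α t) :
    ∃ β : ℂ, ‖β‖ = 1 ∧ z ∉ limZeros α β t := by
  simpa [limZerosAll] using hz

theorem PeriodicLimit.tendsto_coeff (h : PeriodicLimit p t α a) {k N : ℕ → ℕ}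
    (hs : RatioSeq t (fun i => k i * p) N) (j : ℕ) (z : ℂ) :
    Tendsto (fun q : ℕ × ℂ => α (k q.1 * p - j) (N q.1)) (atTop ×ˢ 𝓝 z) (𝓝 (a (p - j))) := by
  have h1 := h.tendsto_sub hs j
  rw [← h.periodic, neg_add_eq_sub] at h1
  exact h1.comp tendsto_fst

/-! ### The ratio limits -/

theorem PeriodicLimit.ratioLimit_opuc_popuc (h : PeriodicLimit p t α a) {β : ℂ} (hβ : ‖β‖ = 1)
    (j : ℕ) :
    RatioLimit p t
      (fun k N => opuc (fun l => α l N) (k * p - j))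
      (fun k N => popuc β (fun l => α l N) (k * p - j + 1))
      (mFun (revCoeff p a β j))
      (limZeros α β t)ᶜ :=
  ratioLimit_of_tendsto fun _ _ hs _ hz => (tendsto_opuc_div_popuc h hs hβ j hz).2

theorem PeriodicLimit.tendsto_opuc_div_star (h : PeriodicLimit p t α a) {k N : ℕ → ℕ}
    (hs : RatioSeq t (fun i => k i * p) N) (j : ℕ) {z : ℂ}
    (hz : z ∈ (limZerosAll α t ∪ poleSet (schurFun (revCoeff p a 1 j)))ᶜ) :
    (∀ᶠ q : ℕ × ℂ in atTop ×ˢ 𝓝 z,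
      (opucStar (fun l => α l (N q.1)) (k q.1 * p - j)).eval q.2 ≠ 0) ∧
    Tendsto (fun q : ℕ × ℂ => (opuc (fun l => α l (N q.1)) (k q.1 * p - j)).eval q.2 /
      (opucStar (fun l => α l (N q.1)) (k q.1 * p - j)).eval q.2)
      (atTop ×ˢ 𝓝 z) (𝓝 (finVal (schurFun (revCoeff p a 1 j) z))) := by
  obtain ⟨β, hβ, hzβ⟩ := exists_not_mem_limZeros (fun h' => hz (Or.inl h'))
  have hne := h.mul_mFun_ne_one hβ j hzβ fun h' => hz (Or.inr h')
  obtain ⟨-, hP, hm⟩ := tendsto_opuc_div_popuc h hs hβ j hzβ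
  obtain ⟨h1, h2, -⟩ := ratio_star_limit hβ hP
    (fun q => h.popuc_eval hβ (k q.1 * p - j) (N q.1) q.2) tendsto_snd hm hne
  rw [h.finVal_schurFun hβ j hzβ hne]
  exact ⟨h1, h2⟩

theorem PeriodicLimit.tendsto_star_div_opuc (h : PeriodicLimit p t α a) {k N : ℕ → ℕ}
    (hs : RatioSeq t (fun i => k i * p) N) (j : ℕ) {z : ℂ}
    (hz : z ∈ (limZerosAll α t ∪ zeroSet (schurFun (revCoeff p a 1 j)))ᶜ) :
    (∀ᶠ q : ℕ × ℂ in atTop ×ˢ 𝓝 z,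
      (opuc (fun l => α l (N q.1)) (k q.1 * p - j)).eval q.2 ≠ 0) ∧
    Tendsto (fun q : ℕ × ℂ => (opucStar (fun l => α l (N q.1)) (k q.1 * p - j)).eval q.2 /
      (opuc (fun l => α l (N q.1)) (k q.1 * p - j)).eval q.2)
      (atTop ×ˢ 𝓝 z) (𝓝 (recipVal (schurFun (revCoeff p a 1 j) z))) := by
  obtain ⟨β, hβ, hzβ⟩ := exists_not_mem_limZeros (fun h' => hz (Or.inl h'))
  have hne := h.mFun_ne_zero hβ j hzβ fun h' => hz (Or.inr h')
  obtain ⟨-, hP, hm⟩ := tendsto_opuc_div_popuc h hs hβ j hzβ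
  obtain ⟨h1, h2, -⟩ := ratio_limit hβ hP
    (fun q => h.popuc_eval hβ (k q.1 * p - j) (N q.1) q.2) tendsto_snd hm hne
  rw [h.recipVal_schurFun hβ j hzβ]
  exact ⟨h1, h2⟩

theorem PeriodicLimit.ratioLimit_star (h : PeriodicLimit p t α a) (j : ℕ) :
    RatioLimit p t
      (fun k N => opucStar (fun l => α l N) (k * p - j + 1))
      (fun k N => opucStar (fun l => α l N) (k * p - j))
      (fun z => 1 - z * a (p - j) * finVal (schurFun (revCoeff p a 1 j) z))
      (limZerosAll α t ∪ poleSet (schurFun (revCoeff p a 1 j)))ᶜ := by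
  refine ratioLimit_of_tendsto fun k N hs z hz => ?_
  obtain ⟨h1, h2⟩ := h.tendsto_opuc_div_star hs j hz
  refine ⟨h1, (((tendsto_snd.mul (h.tendsto_coeff hs j z)).mul h2).const_sub 1).congr' ?_⟩
  filter_upwards [h1] with q hq
  rw [h.opucStar_eval, sub_div, div_self hq]
  ring

theorem PeriodicLimit.ratioLimit_opuc (h : PeriodicLimit p t α a) (j : ℕ) :
    RatioLimit p t
      (fun k N => opuc (fun l => α l N) (k * p - j + 1))
      (fun k N => opuc (fun l => α l N) (k * p - j))
      (fun z => z - conj (a (p - j)) * recipVal (schurFun (revCoeff p a 1 j) z))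
      (limZerosAll α t ∪ zeroSet (schurFun (revCoeff p a 1 j)))ᶜ := by
  refine ratioLimit_of_tendsto fun k N hs z hz => ?_
  obtain ⟨h1, h2⟩ := h.tendsto_star_div_opuc hs j hz
  have h3 := (Complex.continuous_conj.tendsto _).comp (h.tendsto_coeff hs j z)
  refine ⟨h1, (tendsto_snd.sub (h3.mul h2)).congr' ?_⟩
  filter_upwards [h1] with q hq
  rw [h.opuc_eval, sub_div, mul_div_cancel_right₀ _ hq]
  simp only [Function.comp]
  ring

/-! ### The ratio of consecutive POPUC -/

open Classical in
/-- The limit of the ratio of consecutive POPUC. -/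
noncomputable def popucRatio (p : ℕ) (a : ℤ → ℂ) (β : ℂ) (j : ℕ) (z : ℂ) : ℂ :=
  if mFun (revCoeff p a β j) z = 0 then
    (z * mFun (revCoeff p a β (j + 1)) z - 1
      - z * a (p - j - 1) * conj β * mFun (revCoeff p a β (j + 1)) z)
      / (z * mFun (revCoeff p a β j) z - 1)
  else (z * mFun (revCoeff p a β (j + 1)) z
      - conj (a (p - j - 1)) * β * (z * mFun (revCoeff p a β (j + 1)) z - 1))
      / mFun (revCoeff p a β j) z

/-- With n = kp - j, the quotient of the POPUC of degrees n + 1 and n is factored through Φ_n if m ≠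
0 and through Φ_n^* if z m ≠ 1. The second factor, Φ_n or Φ_n^* over the POPUC of degree n, comes
from one Szegő step and the limits for j + 1. -/
theorem PeriodicLimit.tendsto_popuc_div (h : PeriodicLimit p t α a) {k N : ℕ → ℕ}
    (hs : RatioSeq t (fun i => k i * p) N) {β : ℂ} (hβ : ‖β‖ = 1) (j : ℕ) {z : ℂ}
    (hz : z ∉ limZeros α β t) :
    (∀ᶠ q : ℕ × ℂ in atTop ×ˢ 𝓝 z,
      (popuc β (fun l => α l (N q.1)) (k q.1 * p - j)).eval q.2 ≠ 0) ∧
    (mFun (revCoeff p a β j) z ≠ 0 →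
      Tendsto (fun q : ℕ × ℂ => (popuc β (fun l => α l (N q.1)) (k q.1 * p - j + 1)).eval q.2 /
        (popuc β (fun l => α l (N q.1)) (k q.1 * p - j)).eval q.2) (atTop ×ˢ 𝓝 z)
        (𝓝 ((z * mFun (revCoeff p a β (j + 1)) z
          - conj (a (p - j - 1)) * β * (z * mFun (revCoeff p a β (j + 1)) z - 1))
          / mFun (revCoeff p a β j) z))) ∧
    (z * mFun (revCoeff p a β j) z ≠ 1 →
      Tendsto (fun q : ℕ × ℂ => (popuc β (fun l => α l (N q.1)) (k q.1 * p - j + 1)).eval q.2 /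
        (popuc β (fun l => α l (N q.1)) (k q.1 * p - j)).eval q.2) (atTop ×ˢ 𝓝 z)
        (𝓝 ((z * mFun (revCoeff p a β (j + 1)) z - 1
          - z * a (p - j - 1) * conj β * mFun (revCoeff p a β (j + 1)) z)
          / (z * mFun (revCoeff p a β j) z - 1)))) := by
  have hβ' := conj_mul_self_of_norm_eq_one hβ
  obtain ⟨-, hP, hm⟩ := tendsto_opuc_div_popuc h hs hβ j hz
  obtain ⟨-, hP', hm'⟩ := tendsto_opuc_div_popuc h hs hβ (j + 1) hz
  -- Natural subtraction truncates, so this holds only once kp ≥ j + 1.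
  have hidx : ∀ᶠ q : ℕ × ℂ in atTop ×ˢ 𝓝 z, k q.1 * p - (j + 1) + 1 = k q.1 * p - j := by
    filter_upwards [(hs.eventually_le (j + 1)).prod_inl (𝓝 z)] with q hq
    omega
  have hstar' := tendsto_star_div hβ hP'
    (fun q => h.popuc_eval hβ (k q.1 * p - (j + 1)) (N q.1) q.2) tendsto_snd hm'
  have hcoeff := h.tendsto_coeff hs (j + 1) z
  rw [show (p : ℤ) - (j + 1 : ℕ) = p - j - 1 by push_cast; ring] at hcoeff
  have hcoeff' := (Complex.continuous_conj.tendsto _).comp hcoeff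
  refine ⟨?_, fun hm0 => ?_, fun hzm => ?_⟩
  · filter_upwards [hP', hidx] with q h1 h2
    rwa [h2] at h1
  · obtain ⟨hA, -, h2⟩ := ratio_limit hβ hP
      (fun q => h.popuc_eval hβ (k q.1 * p - j) (N q.1) q.2) tendsto_snd hm hm0
    have h3 := h2.mul ((tendsto_snd.mul hm').sub (hcoeff'.mul hstar'))
    rw [show ∀ m x b c e : ℂ, m⁻¹ * (x - c * (b * e)) = (x - c * b * e) / m from
      fun m x b c e => by rw [div_eq_inv_mul]; ring] at h3
    refine h3.congr' ?_
    filter_upwards [hP', hidx, hA] with q e1 e2 e3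
    have e4 := h.opuc_eval (k q.1 * p - (j + 1)) (N q.1) q.2
    rw [e2] at e1 e4 ⊢
    simp only [Function.comp]
    rw [← mul_div_assoc, ← mul_div_assoc, ← sub_div, ← e4]
    field_simp
  · obtain ⟨hB, -, h2⟩ := ratio_star_limit hβ hP
      (fun q => h.popuc_eval hβ (k q.1 * p - j) (N q.1) q.2) tendsto_snd hm hzm
    have h3 := h2.mul (hstar'.sub (hcoeff.mul (tendsto_snd.mul hm')))
    have hlim : conj β / (z * mFun (revCoeff p a β j) z - 1) *
          (β * (z * mFun (revCoeff p a β (j + 1)) z - 1)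
            - a (p - j - 1) * (z * mFun (revCoeff p a β (j + 1)) z))
        = (z * mFun (revCoeff p a β (j + 1)) z - 1
          - z * a (p - j - 1) * conj β * mFun (revCoeff p a β (j + 1)) z)
          / (z * mFun (revCoeff p a β j) z - 1) := by
      rw [div_mul_eq_mul_div]
      congr 1
      linear_combination (z * mFun (revCoeff p a β (j + 1)) z - 1) * hβ'
    rw [hlim] at h3
    refine h3.congr' ?_
    filter_upwards [hP', hidx, hB] with q e1 e2 e3
    have e4 := h.opucStar_eval (k q.1 * p - (j + 1)) (N q.1) q.2
    rw [e2] at e1 e4 ⊢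
    rw [← mul_div_assoc, ← mul_div_assoc, ← sub_div, ← e4]
    field_simp

/-- Where both formulas apply they are limits of the same quotients and hence agree, so no algebraic
relation between the m-functions for j and j + 1 is needed. -/
theorem PeriodicLimit.popucRatio_eq (h : PeriodicLimit p t α a) {β : ℂ} (hβ : ‖β‖ = 1) (j : ℕ)
    {z : ℂ} (hz : z ∉ limZeros α β t) (hzm : z * mFun (revCoeff p a β j) z ≠ 1) :
    popucRatio p a β j z = (z * mFun (revCoeff p a β (j + 1)) z - 1
        - z * a (p - j - 1) * conj β * mFun (revCoeff p a β (j + 1)) z)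
        / (z * mFun (revCoeff p a β j) z - 1) := by
  unfold popucRatio
  split_ifs with hm
  · rfl
  · obtain ⟨k, N, hs⟩ := exists_ratioSeq h.one_le h.pos
    obtain ⟨-, h1, h2⟩ := h.tendsto_popuc_div hs hβ j hz
    exact tendsto_nhds_unique (h1 hm) (h2 hzm)

theorem PeriodicLimit.ratioLimit_popuc (h : PeriodicLimit p t α a) {β : ℂ} (hβ : ‖β‖ = 1)
    (j : ℕ) :
    RatioLimit p t
      (fun k N => popuc β (fun l => α l N) (k * p - j + 1))
      (fun k N => popuc β (fun l => α l N) (k * p - j))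
      (popucRatio p a β j)
      (limZeros α β t)ᶜ := by
  refine ratioLimit_of_tendsto fun k N hs z hz => ?_
  obtain ⟨h0, h1, h2⟩ := h.tendsto_popuc_div hs hβ j hz
  refine ⟨h0, ?_⟩
  unfold popucRatio
  split_ifs with hm
  · exact h2 (by rw [hm]; simp)
  · exact h1 hm

theorem PeriodicLimit.analyticOnNhd_popucRatio (h : PeriodicLimit p t α a) {β : ℂ} (hβ : ‖β‖ = 1)
    (j : ℕ) : AnalyticOnNhd ℂ (popucRatio p a β j) (limZeros α β t)ᶜ := by
  intro z hz
  have hres := h.mem_resolventSet hβ j hz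
  have hA := analyticAt_mFun hres
  have hA' := analyticAt_mFun (h.mem_resolventSet hβ (j + 1) hz)
  have hid : AnalyticAt ℂ (fun w : ℂ => w) z := analyticAt_id
  have hone : AnalyticAt ℂ (fun _ : ℂ => (1 : ℂ)) z := analyticAt_const
  by_cases hm : mFun (revCoeff p a β j) z = 0
  -- Zeros of m lie in the open disk, so a whole neighbourhood avoids the circle and the second
  -- formula represents the function on it.
  · have hlt : ‖z‖ < 1 := by
      by_contra hle
      exact _root_.mFun_ne_zero (h.norm_revCoeff_le hβ j) hres (not_lt.1 hle) hm
    have hzm : z * mFun (revCoeff p a β j) z ≠ 1 := by rw [hm]; simp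
    refine AnalyticAt.congr ((((hid.mul hA').sub hone).sub
      (((hid.mul (analyticAt_const (v := a (p - j - 1)))).mul
        (analyticAt_const (v := conj β))).mul hA')).div
      ((hid.mul hA).sub hone) (sub_ne_zero.2 hzm)) ?_
    filter_upwards [(hid.mul hA).continuousAt.eventually_ne hzm,
      continuous_norm.continuousAt.eventually_lt continuousAt_const hlt] with w h1 h2
    exact (h.popucRatio_eq hβ j (not_mem_limZeros_of_norm_ne_one (ne_of_lt h2)) h1).symm
  · refine AnalyticAt.congr (((hid.mul hA').sub
      ((analyticAt_const (v := conj (a (p - j - 1)) * β)).mul ((hid.mul hA').sub hone))).div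
      hA hm) ?_
    filter_upwards [hA.continuousAt.eventually_ne hm] with w hw
    exact (if_neg hw).symm

theorem PeriodicLimit.popucRatio_eq_recipVal (h : PeriodicLimit p t α a) {β : ℂ} (hβ : ‖β‖ = 1)
    (j : ℕ) {z : ℂ} (hz : z ∉ limZeros α β t)
    (hZ : z ∉ zeroSet (schurFun (revCoeff p a 1 j)))
    (hZ' : z ∉ zeroSet (schurFun (revCoeff p a 1 (j + 1)))) :
    popucRatio p a β j z = mFun (revCoeff p a β (j + 1)) z / mFun (revCoeff p a β j) z *
      (z - conj (a (p - j - 1)) * recipVal (schurFun (revCoeff p a 1 (j + 1)) z)) := by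
  have hm := h.mFun_ne_zero hβ j hz hZ
  have hm' := h.mFun_ne_zero hβ (j + 1) hz hZ'
  rw [h.recipVal_schurFun hβ (j + 1) hz, popucRatio, if_neg hm]
  field_simp

/-- By `conj_mFun_inv` the conjugated values at 1/z̄ are z(1 - z m), so their quotient is that of
the factors z m - 1; this requires z ≠ 0. -/
theorem PeriodicLimit.popucRatio_eq_finVal (h : PeriodicLimit p t α a) {β : ℂ} (hβ : ‖β‖ = 1)
    (j : ℕ) {z : ℂ} (hz0 : z ≠ 0) (hz : z ∉ limZeros α β t)
    (hP : z ∉ poleSet (schurFun (revCoeff p a 1 j)))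
    (hP' : z ∉ poleSet (schurFun (revCoeff p a 1 (j + 1)))) :
    popucRatio p a β j z = conj (mFun (revCoeff p a β (j + 1)) (conj z)⁻¹) /
        conj (mFun (revCoeff p a β j) (conj z)⁻¹) *
      (1 - z * a (p - j - 1) * finVal (schurFun (revCoeff p a 1 (j + 1)) z)) := by
  have hm := h.mul_mFun_ne_one hβ j hz hP
  have hm' := h.mul_mFun_ne_one hβ (j + 1) hz hP'
  rw [h.popucRatio_eq hβ j hz hm, h.finVal_schurFun hβ (j + 1) hz hm',
    conj_mFun_inv (h.norm_revCoeff_le hβ j) (h.mem_resolventSet hβ j hz) hz0,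
    conj_mFun_inv (h.norm_revCoeff_le hβ (j + 1)) (h.mem_resolventSet hβ (j + 1) hz) hz0,
    mul_div_mul_left _ _ hz0, ← neg_sub _ (1 : ℂ), ← neg_sub _ (1 : ℂ), neg_div_neg_eq]
  have e := sub_ne_zero.2 hm
  have e' := sub_ne_zero.2 hm'
  field_simp

end

/-! ### Assembly of the five limits -/

theorem theorem3p5 (p : ℕ) (hp : 1 ≤ p) (β : ℂ) (hβ : ‖β‖ = 1) (t : ℝ) (ht : 0 < t)
    (α : ℕ → ℕ → ℂ) (hα : ∀ n N, ‖α n N‖ < 1)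
    (a : ℤ → ℂ) (ha : ∀ n, ‖a n‖ < 1) (haper : ∀ n, a (n + p) = a n) (hane : ∃ n, a n ≠ 0)
    (hlim : ∀ j < p, ∀ k N : ℕ → ℕ, RatioSeq t (fun i => k i * p) N →
      Tendsto (fun i => α (k i * p + j) (N i)) atTop (𝓝 (a j)))
    (j : ℕ) :
    RatioLimit p t
      (fun k N => opuc (fun l => α l N) (k * p - j))
      (fun k N => popuc β (fun l => α l N) (k * p - j + 1))
      (mFun (revCoeff p a β j))
      (limZeros α β t)ᶜ ∧
    RatioLimit p t
      (fun k N => opuc (fun l => α l N) (k * p - j))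
      (fun k N => opucStar (fun l => α l N) (k * p - j))
      (fun z => finVal (schurFun (revCoeff p a 1 j) z))
      (limZerosAll α t ∪ poleSet (schurFun (revCoeff p a 1 j)))ᶜ ∧
    RatioLimit p t
      (fun k N => opucStar (fun l => α l N) (k * p - j + 1))
      (fun k N => opucStar (fun l => α l N) (k * p - j))
      (fun z => 1 - z * a (p - j) * finVal (schurFun (revCoeff p a 1 j) z))
      (limZerosAll α t ∪ poleSet (schurFun (revCoeff p a 1 j)))ᶜ ∧
    RatioLimit p t
      (fun k N => opuc (fun l => α l N) (k * p - j + 1))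
      (fun k N => opuc (fun l => α l N) (k * p - j))
      (fun z => z - conj (a (p - j)) * recipVal (schurFun (revCoeff p a 1 j) z))
      (limZerosAll α t ∪ zeroSet (schurFun (revCoeff p a 1 j)))ᶜ ∧
    ∃ L : ℂ → ℂ, AnalyticOnNhd ℂ L (limZeros α β t)ᶜ ∧
      (∀ z ∈ (limZeros α β t ∪ zeroSet (schurFun (revCoeff p a 1 j)) ∪
          zeroSet (schurFun (revCoeff p a 1 (j + 1))))ᶜ,
        L z = mFun (revCoeff p a β (j + 1)) z / mFun (revCoeff p a β j) z *
          (z - conj (a (p - j - 1)) * recipVal (schurFun (revCoeff p a 1 (j + 1)) z))) ∧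
      (∀ z ∈ (limZeros α β t ∪ poleSet (schurFun (revCoeff p a 1 j)) ∪
          poleSet (schurFun (revCoeff p a 1 (j + 1))) ∪ {0})ᶜ,
        L z = conj (mFun (revCoeff p a β (j + 1)) (conj z)⁻¹) /
            conj (mFun (revCoeff p a β j) (conj z)⁻¹) *
          (1 - z * a (p - j - 1) * finVal (schurFun (revCoeff p a 1 (j + 1)) z))) ∧
      RatioLimit p t
        (fun k N => popuc β (fun l => α l N) (k * p - j + 1))
        (fun k N => popuc β (fun l => α l N) (k * p - j))
        L
        (limZeros α β t)ᶜ := by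
  have h : PeriodicLimit p t α a :=
    ⟨hp, ht, fun n N => (hα n N).le, fun n => (ha n).le, haper, hlim⟩
  refine ⟨h.ratioLimit_opuc_popuc hβ j,
    ratioLimit_of_tendsto fun k N hs z hz => h.tendsto_opuc_div_star hs j hz,
    h.ratioLimit_star j, h.ratioLimit_opuc j, popucRatio p a β j,
    h.analyticOnNhd_popucRatio hβ j, fun z hz => ?_, fun z hz => ?_, h.ratioLimit_popuc hβ j⟩
  · simp only [Set.mem_compl_iff, Set.mem_union, not_or] at hz
    exact h.popucRatio_eq_recipVal hβ j hz.1.1 hz.1.2 hz.2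
  · simp only [Set.mem_compl_iff, Set.mem_union, not_or, Set.mem_singleton_iff] at hz
    exact h.popucRatio_eq_finVal hβ j hz.2 hz.1.1.1 hz.1.1.2 hz.1.2
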